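/- **Setting.** Let $\|\cdot\|$ be the Euclidean norm of vectors and the operator norm of matrices, and $\preceq$ the Loewner order of symmetric matrices. Consider, for $T>0$ and $x_0\in\mathbb R^{n_x}$, the linear-quadratic problem $$\min_{u,x}\ \tfrac12\int_0^T\big(x^\top Qx+2u^\top Hx+u^\top Ru\big)\,dt+\tfrac12x(T)^\top Q_Tx(T)\quad\text{s.t. }\dot x=Ax+Bu \text{ on } (0,T],\quad x(0)=x_0,$$ over bounded controls $u$, where $A,B,Q,H,R$ are continuous matrix functions on $[0,T]$. Let $\Phi_A(t,s)$ be the evolution operator of $\dot x=A(t)x$ and $W(t_0,t_1)=\int_{t_0}^{t_1}\Phi_A(t_0,s)B(s)B(s)^\top\Phi_A(t_0,s)^\top ds$. Assume: 1. $\|A\|\le\lambda_A$, $\|B\|\le\lambda_B$, $\|Q\|\le\lambda_Q$, $\|H\|\le\lambda_H$, $\|R\|\le\lambda_R$ on $[0,T]$, with positive constants; 2. there are $\sigma\in(0,T)$ and $\alpha_0,\alpha_1,\beta_0,\beta_1>0$ such that for every $t_0\in[0,T-\sigma]$ there is $t_1\in[t_0,t_0+\sigma]$ with $\alpha_0I\preceq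 W(t_0,t_1)\preceq\alpha_1I$ and $\beta_0I\preceq\Phi_A(t_1,t_0)W(t_0,t_1)\Phi_A(t_1,t_0)^\top\preceq\beta_1I$; 3. $R\succeq\gamma_RI$ and $Q-H^\top R^{-1}H\succeq\gamma_QI$ on $[0,T]$, and $\gamma_QI\preceq Q_T\preceq\lambda_QI$, with $\gamma_R>0$ and $\lambda_Q\ge\gamma_Q>0$. For this problem and for the subproblems below, a solution $(x,u,\lambda)$ on $[a,b]$ with terminal cost $L$ consists of an optimal pair $(x,u)$ with $u$ continuous and the adjoint $\lambda$, i.e. $\dot\lambda=-Qx-H^\top u-A^\top\lambda$ on $[a,b]$, $\lambda(b)=\nabla L(x(b))$. Let $(x^*,u^*,\lambda^*)$ be the solution of the full problem. **Schwarz iteration.** Let $0=t_0<t_1<\dots<t_m=T$, $\tau_j^0,\tau_j^1>0$, $t_j^0=\max\{t_{j-1}-\tau_j^0,0\}$, $t_j^1=\min\{t_j+\tau_j^1,T\}$ for $1\le j\le m$, and $\tau=\min_j\min\{\tau_j^0,\tau_j^1\}$. Let $(x^{(0)},u^{(0)},\lambda^{(0)})$ be any functions on $[0,T]$ with $x^{(0)}(0)=x_0$.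 For $k\ge1$ and $1\le j\le m$ let $p=x^{(k-1)}(t_j^0)$, $q=x^{(k-1)}(t_j^1)-Q(t_j^1)^{-1}\lambda^{(k-1)}(t_j^1)$, and let $(x^{(k)}_j,u^{(k)}_j,\lambda^{(k)}_j)$ be the solution on $[t_j^0,t_j^1]$ of the problem of minimizing $$\tfrac12\int_{t_j^0}^{t_j^1}\big(x^\top Qx+2u^\top Hx+u^\top Ru\big)\,dt+L_j(x(t_j^1))\quad\text{s.t. }\dot x=Ax+Bu,\quad x(t_j^0)=p,$$ where $L_j(z)=\tfrac12z^\top Q(t_j^1)z-z^\top Q(t_j^1)q$ if $j<m$ and $L_m(z)=\tfrac12z^\top Q_Tz$. The iterate $(x^{(k)},u^{(k)},\lambda^{(k)})$ is defined to be $(x_j^{(k)},u_j^{(k)},\lambda_j^{(k)})$ on $[t_{j-1},t_j)$ if $j<m$ and on $[t_{m-1},t_m]$ if $j=m$. **Constants.** Put $a=\lambda_A+\lambda_B\lambda_H/\gamma_R$ and $$\alpha_1'=\frac{\lambda_B^2(e^{2a\sigma}-1)}{2a},\qquad \alpha_0'=\Big(\frac2{\alpha_0}+\frac{\lambda_H^2}{\gamma_R^2\lambda_A}\Big(1+\frac{\alpha_1}{\alpha_0}\Big)^2(e^{2\lambda_A\sigma}-1)\Big)^{-1},$$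 $$\tilde\alpha_0=\frac{1-e^{-2a\sigma}}{2a},\qquad \tilde\alpha_1=\frac{e^{2a\sigma}-1}{2a},$$ $$c_0=\min\Big\{2a\Big(\frac{\lambda_B^2}{\gamma_R}\Big(1+\frac{\tilde\alpha_1}{\tilde\alpha_0}\Big)^2+\frac1{\gamma_Q\tilde\alpha_0^2}\Big)^{-1},\Big(\frac{\lambda_B^2}{2\gamma_Ra}+\frac1{\gamma_Q}\Big)^{-1}\Big\}e^{-2a\sigma},$$ $$c_1=\max\Big\{\Big(\Big(\lambda_Q+\frac{\lambda_H^2}{\gamma_R}\Big)\Big(1+\frac{\alpha_1'}{\alpha_0'}\Big)^2+\frac{\lambda_R\lambda_B^2}{\alpha_0'^2}\Big)\frac1{2a},\Big(\lambda_Q+\frac{\lambda_H^2}{\gamma_R}\Big)\Big(1+\frac1{2a}\Big)\Big\}e^{2a\sigma},$$ $$c_Z=\sqrt{c_1/c_0},\qquad \rho_Z(\sigma)=\frac{\gamma_Q}{2c_1},$$ $$\Lambda_b=\Big\{1+\frac{\lambda_H}{\gamma_R}+\Big(1+\frac{\lambda_B}{\gamma_R}\Big)(c_1+\lambda_Q)\Big\}\max\Big\{c_Z,\frac{c_Z^2\lambda_B^2\lambda_Q}{2\rho_Z(\sigma)\gamma_R}\Big\},\qquad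 c(\sigma)=\Lambda_b\Big(1+\frac1{\gamma_Q}\Big).$$ **Claim.** Let $k\ge1$ and let $1\le j\le m$ be such that $j=m$ or $t_j+\tau\le T$. Then for all $t\in[t_{j-1},t_j]$ $$\|x_j^{(k)}(t)-x^*(t)\|+\|u_j^{(k)}(t)-u^*(t)\|+\|\lambda_j^{(k)}(t)-\lambda^*(t)\|\le c(\sigma)e^{-\rho_Z(\sigma)\tau}\,E_j^{(k-1)},$$ where $$E_j^{(k-1)}=\|x^{(k-1)}(t_j^0)-x^*(t_j^0)\|+\big\{\|x^{(k-1)}(t_j^1)-x^*(t_j^1)\|+\|\lambda^{(k-1)}(t_j^1)-\lambda^*(t_j^1)\|\big\}\mathbf 1_{j\ne m}.$$ In particular, $\|x^{(k)}(t)-x^*(t)\|+\|u^{(k)}(t)-u^*(t)\|+\|\lambda^{(k)}(t)-\lambda^*(t)\|\le c(\sigma)e^{-\rho_Z(\sigma)\tau}E_j^{(k-1)}$ for all $t\in[t_{j-1},t_j)$ if $j<m$, and for all $t\in[t_{m-1},t_m]$ if $j=m$. -/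

import Mathlib

open Set MeasureTheory

noncomputable section

namespace Schwarz

/-- `ℝⁿ` with the `ℓ₂` norm.  A real `p × q` matrix is represented by the linear map
`Vec q →L[ℝ] Vec p`; its norm is the operator norm, its transpose is the adjoint, and `≤` between
square matrices is the Loewner order (the difference is symmetric positive semidefinite). -/
abbrev Vec (n : ℕ) : Type := EuclideanSpace ℝ (Fin n)

/-! ### Evolution operator and controllability Gramian -/

/-- Terms of the Peano–Baker series: `I₀(t,s) = I`, `Iₙ₊₁(t,s) = ∫ₛᵗ A(r) Iₙ(r,s) dr`. -/
def peanoBaker {n : ℕ} (A : ℝ → Vec n →L[ℝ] Vec n) : ℕ → ℝ → ℝ → (Vec n →L[ℝ] Vec n)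
  | 0, _, _ => 1
  | i + 1, t, s => ∫ r in s..t, A r ∘L peanoBaker A i r s

/-- The evolution operator `Φ_A(t,s)` of `ẋ(t) = A(t) x(t)`, that is `∂ₜ Φ_A(t,s) = A(t) Φ_A(t,s)`,
`Φ_A(s,s) = I`, given by the Peano–Baker series (convergent for continuous `A`). -/
def evolution {n : ℕ} (A : ℝ → Vec n →L[ℝ] Vec n) (t s : ℝ) : Vec n →L[ℝ] Vec n :=
  ∑' i, peanoBaker A i t s

/-- Controllability Gramian
`W_{A,B}(t₀,t₁) = ∫_{t₀}^{t₁} Φ_A(t₀,s) B(s) B(s)ᵀ Φ_A(t₀,s)ᵀ ds`. -/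
def gramian {n l : ℕ} (A : ℝ → Vec n →L[ℝ] Vec n) (B : ℝ → Vec l →L[ℝ] Vec n) (t₀ t₁ : ℝ) :
    Vec n →L[ℝ] Vec n :=
  ∫ s in t₀..t₁, (evolution A t₀ s ∘L B s) ∘L (evolution A t₀ s ∘L B s).adjoint

/-! ### The linear-quadratic optimal control problem -/

/-- Data of the linear-quadratic problem on `[0, T]`; only the values of the matrix functions on
`[0, T]` matter. -/
structure Problem (nx nu : ℕ) where
  T : ℝ
  A : ℝ → Vec nx →L[ℝ] Vec nx
  B : ℝ → Vec nu →L[ℝ] Vec nx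
  Q : ℝ → Vec nx →L[ℝ] Vec nx
  H : ℝ → Vec nx →L[ℝ] Vec nu
  R : ℝ → Vec nu →L[ℝ] Vec nu
  QT : Vec nx →L[ℝ] Vec nx
  x₀ : Vec nx

/-- The constants that occur in the assumptions. -/
structure Constants where
  lamA : ℝ
  lamB : ℝ
  lamQ : ℝ
  lamH : ℝ
  lamR : ℝ
  gamR : ℝ
  gamQ : ℝ
  σ : ℝ
  α₀ : ℝ
  α₁ : ℝ
  β₀ : ℝ
  β₁ : ℝ

/-- Continuity and boundedness of the problem matrices. -/
structure BoundedMatrices {nx nu : ℕ} (P : Problem nx nu) (K : Constants) : Prop where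
  lamA_pos : 0 < K.lamA
  lamB_pos : 0 < K.lamB
  lamQ_pos : 0 < K.lamQ
  lamH_pos : 0 < K.lamH
  lamR_pos : 0 < K.lamR
  contA : ContinuousOn P.A (Icc 0 P.T)
  contB : ContinuousOn P.B (Icc 0 P.T)
  contQ : ContinuousOn P.Q (Icc 0 P.T)
  contH : ContinuousOn P.H (Icc 0 P.T)
  contR : ContinuousOn P.R (Icc 0 P.T)
  normA : ∀ t ∈ Icc 0 P.T, ‖P.A t‖ ≤ K.lamA
  normB : ∀ t ∈ Icc 0 P.T, ‖P.B t‖ ≤ K.lamB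
  normQ : ∀ t ∈ Icc 0 P.T, ‖P.Q t‖ ≤ K.lamQ
  normH : ∀ t ∈ Icc 0 P.T, ‖P.H t‖ ≤ K.lamH
  normR : ∀ t ∈ Icc 0 P.T, ‖P.R t‖ ≤ K.lamR

/-- Uniform complete controllability of the pair `(A, B)`. -/
structure UniformlyControllable {nx nu : ℕ} (P : Problem nx nu) (K : Constants) : Prop where
  σ_pos : 0 < K.σ
  σ_lt : K.σ < P.T
  α₀_pos : 0 < K.α₀
  α₁_pos : 0 < K.α₁
  β₀_pos : 0 < K.β₀
  β₁_pos : 0 < K.β₁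
  bounds : ∀ t₀ ∈ Icc 0 (P.T - K.σ), ∃ t₁ ∈ Icc t₀ (t₀ + K.σ),
    K.α₀ • (1 : Vec nx →L[ℝ] Vec nx) ≤ gramian P.A P.B t₀ t₁ ∧
    gramian P.A P.B t₀ t₁ ≤ K.α₁ • (1 : Vec nx →L[ℝ] Vec nx) ∧
    K.β₀ • (1 : Vec nx →L[ℝ] Vec nx) ≤
      evolution P.A t₁ t₀ ∘L gramian P.A P.B t₀ t₁ ∘L (evolution P.A t₁ t₀).adjoint ∧
    evolution P.A t₁ t₀ ∘L gramian P.A P.B t₀ t₁ ∘L (evolution P.A t₁ t₀).adjoint ≤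
      K.β₁ • (1 : Vec nx →L[ℝ] Vec nx)

/-- Coercivity of the cost. -/
structure Coercive {nx nu : ℕ} (P : Problem nx nu) (K : Constants) : Prop where
  gamR_pos : 0 < K.gamR
  gamQ_pos : 0 < K.gamQ
  gamQ_le : K.gamQ ≤ K.lamQ
  lowerR : ∀ t ∈ Icc 0 P.T, K.gamR • (1 : Vec nu →L[ℝ] Vec nu) ≤ P.R t
  lowerQ : ∀ t ∈ Icc 0 P.T, K.gamQ • (1 : Vec nx →L[ℝ] Vec nx) ≤
    P.Q t - (P.H t).adjoint ∘L (P.R t).inverse ∘L P.H t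
  lowerQT : K.gamQ • (1 : Vec nx →L[ℝ] Vec nx) ≤ P.QT
  upperQT : P.QT ≤ K.lamQ • (1 : Vec nx →L[ℝ] Vec nx)

/-- `(x, u)` is admissible on `[a, b]` with initial state `p`: the control is bounded (and
measurable), and `x` is the continuous solution of `ẋ = A x + B u`, `x(a) = p`, in integrated
form. -/
structure Admissible {nx nu : ℕ} (P : Problem nx nu) (a b : ℝ) (p : Vec nx)
    (x : ℝ → Vec nx) (u : ℝ → Vec nu) : Prop where
  measurable_control : AEStronglyMeasurable u (volume.restrict (Icc a b))
  bounded_control : ∃ M : ℝ, ∀ t ∈ Icc a b, ‖u t‖ ≤ M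
  continuous_state : ContinuousOn x (Icc a b)
  dynamics : ∀ t ∈ Icc a b, x t = p + ∫ s in a..t, (P.A s (x s) + P.B s (u s))

/-- Bolza cost on `[a, b]` with terminal cost `L`. -/
def cost {nx nu : ℕ} (P : Problem nx nu) (a b : ℝ) (L : Vec nx → ℝ)
    (x : ℝ → Vec nx) (u : ℝ → Vec nu) : ℝ :=
  (1 / 2) * (∫ t in a..b, (inner ℝ (x t) (P.Q t (x t)) + 2 * inner ℝ (u t) (P.H t (x t))
    + inner ℝ (u t) (P.R t (u t)))) + L (x b)

/-- `(x, u, lam)` is the optimal state, control and adjoint of the problem of minimizing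
`cost P a b L` over the admissible pairs with initial state `p`.  The optimal control is the
continuous one; the adjoint solves the costate equation `λ̇ = -∇ₓℋ = -(Q x + Hᵀ u + Aᵀ λ)`,
`λ(b) = ∇L(x(b))`. -/
structure IsSolution {nx nu : ℕ} (P : Problem nx nu) (a b : ℝ) (p : Vec nx) (L : Vec nx → ℝ)
    (x : ℝ → Vec nx) (u : ℝ → Vec nu) (lam : ℝ → Vec nx) : Prop where
  admissible : Admissible P a b p x u
  optimal : ∀ x' u', Admissible P a b p x' u' → cost P a b L x u ≤ cost P a b L x' u'
  continuous_control : ContinuousOn u (Icc a b)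
  adjoint_eq : ∀ t ∈ Icc a b, HasDerivWithinAt lam
    (-(P.Q t (x t) + (P.H t).adjoint (u t) + (P.A t).adjoint (lam t))) (Icc a b) t
  adjoint_end : HasGradientAt L (lam b) (x b)

/-- Terminal cost `½ xᵀ Q_T x` of the full problem. -/
def fullTerminalCost {nx nu : ℕ} (P : Problem nx nu) (z : Vec nx) : ℝ :=
  (1 / 2) * inner ℝ z (P.QT z)

/-- `(x, u, lam)` solves the full problem on `[0, T]`. -/
def IsFullSolution {nx nu : ℕ} (P : Problem nx nu)
    (x : ℝ → Vec nx) (u : ℝ → Vec nu) (lam : ℝ → Vec nx) : Prop :=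
  IsSolution P 0 P.T P.x₀ (fullTerminalCost P) x u lam

/-! ### Overlapping decomposition and the Schwarz iteration -/

/-- A partition `0 = t₀ < ⋯ < t_m = T` with backward and forward overlap parameters.  The
subdomain with number `j + 1` of `1, …, m` is indexed by `j : Fin m`, so its end points are
`t j.castSucc` and `t j.succ`. -/
structure Decomposition (T : ℝ) (m : ℕ) where
  t : Fin (m + 1) → ℝ
  strictMono : StrictMono t
  t_zero : t 0 = 0
  t_last : t (Fin.last m) = T
  τ₀ : Fin m → ℝ
  τ₁ : Fin m → ℝ
  τ₀_pos : ∀ j, 0 < τ₀ j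
  τ₁_pos : ∀ j, 0 < τ₁ j

namespace Decomposition

variable {T : ℝ} {m : ℕ}

/-- Left end of the overlapping subdomain. -/
def left (D : Decomposition T m) (j : Fin m) : ℝ := max (D.t j.castSucc - D.τ₀ j) 0

/-- Right end of the overlapping subdomain. -/
def right (D : Decomposition T m) (j : Fin m) : ℝ := min (D.t j.succ + D.τ₁ j) T

/-- The smallest overlap parameter. -/
def τ (D : Decomposition T m) : ℝ := ⨅ j, min (D.τ₀ j) (D.τ₁ j)

/-- The part of `[0, T]` on which the aggregated iterate is the `j`-th piece: half-open for all
subdomains but the last. -/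
def cell (D : Decomposition T m) (j : Fin m) : Set ℝ :=
  if j.succ = Fin.last m then Icc (D.t j.castSucc) (D.t j.succ)
  else Ico (D.t j.castSucc) (D.t j.succ)

end Decomposition

/-- Terminal cost of the `j`-th subproblem with target parameter `q`. -/
def subTerminalCost {nx nu m : ℕ} (P : Problem nx nu) (D : Decomposition P.T m) (j : Fin m)
    (q z : Vec nx) : ℝ :=
  if j.succ = Fin.last m then (1 / 2) * inner ℝ z (P.QT z)
  else (1 / 2) * inner ℝ z (P.Q (D.right j) z) - inner ℝ z (P.Q (D.right j) q)

/-- `(x, u, lam)` solves the `j`-th subproblem with boundary parameters `p`, `q`. -/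
def IsSubSolution {nx nu m : ℕ} (P : Problem nx nu) (D : Decomposition P.T m) (j : Fin m)
    (p q : Vec nx) (x : ℝ → Vec nx) (u : ℝ → Vec nu) (lam : ℝ → Vec nx) : Prop :=
  IsSolution P (D.left j) (D.right j) p (subTerminalCost P D j q) x u lam

/-- A run of the overlapping Schwarz iteration: `(x k, u k, lam k)` are the aggregated iterates and
`(xs k j, us k j, lams k j)`, `k ≥ 1`, the solutions of the subproblems. -/
structure IsSchwarzRun {nx nu m : ℕ} (P : Problem nx nu) (D : Decomposition P.T m)
    (x : ℕ → ℝ → Vec nx) (u : ℕ → ℝ → Vec nu) (lam : ℕ → ℝ → Vec nx)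
    (xs : ℕ → Fin m → ℝ → Vec nx) (us : ℕ → Fin m → ℝ → Vec nu)
    (lams : ℕ → Fin m → ℝ → Vec nx) : Prop where
  init : x 0 0 = P.x₀
  solve : ∀ k j, IsSubSolution P D j (x k (D.left j))
    (x k (D.right j) - (P.Q (D.right j)).inverse (lam k (D.right j)))
    (xs (k + 1) j) (us (k + 1) j) (lams (k + 1) j)
  aggregate : ∀ k j, ∀ t ∈ D.cell j,
    x (k + 1) t = xs (k + 1) j t ∧ u (k + 1) t = us (k + 1) j t ∧
      lam (k + 1) t = lams (k + 1) j t

/-- Error at the boundary of the `j`-th subdomain: the state error at the left end, plus the state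
and adjoint errors at the right end unless `j` is the last subdomain. -/
def boundaryError {nx m : ℕ} {T : ℝ} (D : Decomposition T m) (j : Fin m)
    (x lam xStar lamStar : ℝ → Vec nx) : ℝ :=
  ‖x (D.left j) - xStar (D.left j)‖ +
    if j.succ = Fin.last m then 0
    else ‖x (D.right j) - xStar (D.right j)‖ + ‖lam (D.right j) - lamStar (D.right j)‖

/-! ### The explicit constants -/

namespace Constants

/-- Growth rate `λ_A + λ_B λ_H / γ_R` of the shifted system `A - B R⁻¹ H`. -/
def growth (K : Constants) : ℝ := K.lamA + K.lamB * (K.lamH / K.gamR)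

/-- Upper bound of the Gramian of the pair `(A - B R⁻¹ H, B)`. -/
def α₁' (K : Constants) : ℝ :=
  K.lamB ^ 2 * (Real.exp (2 * K.σ * K.growth) - 1) / (2 * K.growth)

/-- Lower bound of the Gramian of the pair `(A - B R⁻¹ H, B)`. -/
def α₀' (K : Constants) : ℝ :=
  (2 / K.α₀ + (K.lamH / K.gamR) ^ 2 / K.lamA * (1 + K.α₁ / K.α₀) ^ 2 *
    (Real.exp (2 * K.lamA * K.σ) - 1))⁻¹

/-- Lower bound of the Gramian of the dual pair `(-(A - B R⁻¹ H)ᵀ, I)`. -/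
def dualα₀ (K : Constants) : ℝ := (1 - Real.exp (-2 * K.growth * K.σ)) / (2 * K.growth)

/-- Upper bound of the Gramian of the dual pair `(-(A - B R⁻¹ H)ᵀ, I)`. -/
def dualα₁ (K : Constants) : ℝ := (Real.exp (2 * K.growth * K.σ) - 1) / (2 * K.growth)

/-- Lower bound of the Riccati matrix. -/
def c₀ (K : Constants) : ℝ :=
  min (2 * K.growth * (K.lamB ^ 2 / K.gamR * (1 + K.dualα₁ / K.dualα₀) ^ 2
        + 1 / (K.gamQ * K.dualα₀ ^ 2))⁻¹)
      (K.lamB ^ 2 / (2 * K.gamR * K.growth) + 1 / K.gamQ)⁻¹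
    * Real.exp (-2 * K.growth * K.σ)

/-- Upper bound of the Riccati matrix. -/
def c₁ (K : Constants) : ℝ :=
  max (((K.lamQ + K.lamH ^ 2 / K.gamR) * (1 + K.α₁' / K.α₀') ^ 2
        + K.lamR * K.lamB ^ 2 / K.α₀' ^ 2) * (1 / (2 * K.growth)))
      ((K.lamQ + K.lamH ^ 2 / K.gamR) * (1 + 1 / (2 * K.growth)))
    * Real.exp (2 * K.growth * K.σ)

/-- `c_Z(σ)`. -/
def cZ (K : Constants) : ℝ := √(K.c₁ / K.c₀)

/-- The decay rate `ρ_Z(σ)`. -/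
def ρZ (K : Constants) : ℝ := K.gamQ / (2 * K.c₁)

/-- `Λ_b(σ)`, for a bound `lamG` of the terminal parameter matrix. -/
def Λb (K : Constants) (lamG : ℝ) : ℝ :=
  (1 + K.lamH / K.gamR + (1 + K.lamB / K.gamR) * (K.c₁ + lamG)) *
    max K.cZ (K.cZ ^ 2 * K.lamB ^ 2 * lamG / (2 * K.ρZ * K.gamR))

/-- `c(σ) = Λ_b(σ) (1 + 1 / γ_Q)`, with `λ_G = λ_Q`. -/
def c (K : Constants) : ℝ := K.Λb K.lamQ * (1 + 1 / K.gamQ)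

end Constants

end Schwarz

end

/-! The optimality conditions of a linear-quadratic problem form a linear Hamiltonian system, so the
difference between a subproblem solution and the restriction of `(x*, u*, λ*)` is again an extremal
(`IsSolution.isExtremal`, `IsExtremal.sub`). It remains to bound an extremal on `[a, b]` by its
initial state `x(a)` and its terminal defect `λ(b) - G x(b)`, where `G` is `Q(b)` or `Q_T`, with
exponential decay away from each end (`IsExtremal.norm_le_boundary`).

Suppose first that the defect is zero. Then `V = ⟨λ, x⟩` is twice the optimal cost to go, and `V' =
-(running cost) ≤ -γ_Q ‖x‖²`. If `c₀ ‖x‖² ≤ V ≤ c₁ ‖x‖²`, then `V` decays at rate `γ_Q / c₁ = 2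
ρ_Z`, hence `x` at rate `ρ_Z` with factor `c_Z` (`IsExtremal.norm_le_exp_mul`). The upper bound
compares `V` with the cost of a test trajectory, steered to the origin through the Gramian or, near
the end, left uncontrolled (`IsExtremal.inner_le_c₁_mul`). The lower bound is weak duality, tested
with affine adjoint arcs (`IsExtremal.c₀_mul_le_inner`).

For a general defect, take the matrix solution `(X, Λ)` with `X(b) = I`, `Λ(b) = G`, and put `S =
ΛX⁻¹`. Its columns have zero defect, so `X(t)X(s)⁻¹` decays and `0 ≤ S ≤ c₁`. Constancy of the
symplectic pairing shows that `r = λ - Sx` decays away from `b` (`norm_defect_le`). Variation of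
constants `x = Xz`, where `z'` is driven by `r`, then bounds `x` (`norm_state_le`), and `λ = Sx + r`
and stationarity bound `λ` and `u`.

In the Schwarz iteration, the left end is either time `0`, where the error vanishes, or at distance
at least `τ` from the cell. At the right end the terminal cost is such that the defect of the error
is `(λ - λ*) - Q(x - x*)` evaluated at the previous iterate. This gives `IsSubSolution.error_le`. -/

noncomputable section

/-! ### Fundamental solutions of linear differential equations -/

namespace LinearODE

variable {𝔸 : Type*} [NormedRing 𝔸] [NormedAlgebra ℝ 𝔸]

/-- Terms of the Peano–Baker series in a normed algebra. -/
def seriesTerm (A : ℝ → 𝔸) : ℕ → ℝ → ℝ → 𝔸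
  | 0, _, _ => 1
  | i + 1, t, s => ∫ r in s..t, A r * seriesTerm A i r s

/-- The fundamental solution of `Ẏ = A Y`, as the sum of the Peano–Baker series. -/
def fundamental (A : ℝ → 𝔸) (t s : ℝ) : 𝔸 := ∑' i, seriesTerm A i t s

variable {A : ℝ → 𝔸} {M : ℝ}

theorem continuous_seriesTerm (hA : Continuous A) (i : ℕ) (s : ℝ) :
    Continuous fun t => seriesTerm A i t s := by
  induction i with
  | zero => exact continuous_const
  | succ i ih =>
    exact intervalIntegral.continuous_primitive
      (fun a b => (hA.mul ih).intervalIntegrable a b) s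

theorem fundamental_self (s : ℝ) : fundamental A s s = 1 := by
  rw [fundamental, tsum_eq_single 0]
  · rfl
  · rintro (_ | i) hi
    · exact absurd rfl hi
    · exact intervalIntegral.integral_same

/-- Integrating `|r - s| ^ i` produces the factorial. The hypothesis `‖1‖ ≤ 1`, instead of equality,
admits operators on a zero-dimensional space. -/
theorem norm_seriesTerm_le (hA : Continuous A) (hM : ∀ t, ‖A t‖ ≤ M) (h1 : ‖(1 : 𝔸)‖ ≤ 1)
    (i : ℕ) (t s : ℝ) : ‖seriesTerm A i t s‖ ≤ (M * |t - s|) ^ i / i.factorial := by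
  induction i generalizing t with
  | zero => simpa [seriesTerm] using h1
  | succ i ih =>
    have hM0 : 0 ≤ M := (norm_nonneg _).trans (hM 0)
    have key : ∀ r, ‖A r * seriesTerm A i r s‖ ≤ M ^ (i + 1) / i.factorial * |r - s| ^ i := by
      intro r
      calc ‖A r * seriesTerm A i r s‖ ≤ ‖A r‖ * ‖seriesTerm A i r s‖ := norm_mul_le _ _
        _ ≤ M * ((M * |r - s|) ^ i / i.factorial) := by gcongr; exacts [hM r, ih r]
        _ = _ := by rw [mul_pow]; ring
    calc ‖seriesTerm A (i + 1) t s‖ ≤ ∫ r in uIoc s t, ‖A r * seriesTerm A i r s‖ :=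
          intervalIntegral.norm_integral_le_integral_norm_uIoc
      _ ≤ ∫ r in uIoc s t, M ^ (i + 1) / i.factorial * |r - s| ^ i := by
          refine integral_mono ?_ ?_ key
          · exact intervalIntegrable_iff.1
              ((hA.mul (continuous_seriesTerm hA i s)).norm.intervalIntegrable s t)
          · exact intervalIntegrable_iff.1 (Continuous.intervalIntegrable (by fun_prop) s t)
      _ = _ := by
          rw [integral_const_mul, integral_pow_abs_sub_uIoc, mul_pow, Nat.factorial_succ]
          push_cast
          field_simp

theorem norm_fundamental_le (hA : Continuous A) (hM : ∀ t, ‖A t‖ ≤ M) (h1 : ‖(1 : 𝔸)‖ ≤ 1)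
    (t s : ℝ) : ‖fundamental A t s‖ ≤ Real.exp (M * |t - s|) := by
  refine tsum_of_norm_bounded ?_ fun i => norm_seriesTerm_le hA hM h1 i t s
  rw [Real.exp_eq_exp_ℝ]
  exact NormedSpace.expSeries_div_hasSum_exp _

variable [CompleteSpace 𝔸]

theorem hasDerivAt_seriesTerm_succ (hA : Continuous A) (i : ℕ) (t s : ℝ) :
    HasDerivAt (fun t => seriesTerm A (i + 1) t s) (A t * seriesTerm A i t s) t :=
  ((hA.mul (continuous_seriesTerm hA i s)).integral_hasStrictDerivAt s t).hasDerivAt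

theorem summable_seriesTerm (hA : Continuous A) (hM : ∀ t, ‖A t‖ ≤ M) (h1 : ‖(1 : 𝔸)‖ ≤ 1)
    (t s : ℝ) : Summable fun i => seriesTerm A i t s :=
  .of_norm_bounded (Real.summable_pow_div_factorial _) fun i => norm_seriesTerm_le hA hM h1 i t s

theorem hasDerivAt_fundamental (hA : Continuous A) (hM : ∀ t, ‖A t‖ ≤ M) (h1 : ‖(1 : 𝔸)‖ ≤ 1)
    (t s : ℝ) : HasDerivAt (fun t => fundamental A t s) (A t * fundamental A t s) t := by
  have hM0 : 0 ≤ M := (norm_nonneg _).trans (hM 0)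
  have hsum := summable_seriesTerm hA hM h1
  have hsplit : ∀ r, fundamental A r s = 1 + ∑' i, seriesTerm A (i + 1) r s := fun r =>
    (hsum r s).tsum_eq_zero_add
  simp only [hsplit]
  refine HasDerivAt.const_add 1 ?_
  rw [← hsplit, fundamental, ← (hsum t s).tsum_mul_left]
  -- Termwise differentiation needs a uniform summable bound on a connected open set. A ball about
  -- `s` containing `t` works, as the series converges trivially at `s`.
  set ρ : ℝ := |t - s| + 1 with hρ
  have hs : s ∈ Metric.ball s ρ := Metric.mem_ball_self (by positivity)
  have ht : t ∈ Metric.ball s ρ := by rw [Metric.mem_ball, Real.dist_eq]; simp [hρ]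
  refine hasDerivAt_tsum_of_isPreconnected (u := fun i : ℕ => M * ((M * ρ) ^ i / i.factorial))
    ((Real.summable_pow_div_factorial _).mul_left M) Metric.isOpen_ball
    (convex_ball s ρ).isPreconnected (fun i r _ => hasDerivAt_seriesTerm_succ hA i r s) ?_ hs
    ((summable_nat_add_iff 1).2 (hsum s s)) ht
  intro i r hr
  rw [Metric.mem_ball, Real.dist_eq] at hr
  calc ‖A r * seriesTerm A i r s‖ ≤ ‖A r‖ * ‖seriesTerm A i r s‖ := norm_mul_le _ _
    _ ≤ M * ((M * ρ) ^ i / i.factorial) := by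
      gcongr
      · exact hM r
      · exact (norm_seriesTerm_le hA hM h1 i r s).trans (by gcongr)

/-- As functions of `t`, both sides solve `Ẏ = A Y` and agree at `t = s`. -/
theorem fundamental_mul (hA : Continuous A) (hM : ∀ t, ‖A t‖ ≤ M) (h1 : ‖(1 : 𝔸)‖ ≤ 1)
    (t s r : ℝ) : fundamental A t s * fundamental A s r = fundamental A t r := by
  have hM0 : 0 ≤ M := (norm_nonneg _).trans (hM 0)
  refine congrFun (ODE_solution_unique_univ (K := M.toNNReal) (v := fun t Y => A t * Y)
    (s := fun _ => univ) (t₀ := s) (f := fun t => fundamental A t s * fundamental A s r)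
    (g := fun t => fundamental A t r) ?_ ?_ ?_ ?_) t
  · refine fun t => LipschitzWith.lipschitzOnWith (LipschitzWith.of_dist_le_mul fun Y Z => ?_)
    rw [Real.coe_toNNReal _ hM0, dist_eq_norm, dist_eq_norm, ← mul_sub]
    exact (norm_mul_le _ _).trans (by gcongr; exact hM t)
  · refine fun t => ⟨?_, mem_univ _⟩
    rw [← mul_assoc]
    exact (hasDerivAt_fundamental hA hM h1 t s).mul_const _
  · exact fun t => ⟨hasDerivAt_fundamental hA hM h1 t r, mem_univ _⟩
  · simp only [fundamental_self, one_mul]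

theorem fundamental_mul_swap (hA : Continuous A) (hM : ∀ t, ‖A t‖ ≤ M) (h1 : ‖(1 : 𝔸)‖ ≤ 1)
    (t s : ℝ) : fundamental A t s * fundamental A s t = 1 := by
  rw [fundamental_mul hA hM h1, fundamental_self]

theorem continuous_fundamental_left (hA : Continuous A) (hM : ∀ t, ‖A t‖ ≤ M)
    (h1 : ‖(1 : 𝔸)‖ ≤ 1) (s : ℝ) : Continuous fun t => fundamental A t s :=
  continuous_iff_continuousAt.2 fun t => (hasDerivAt_fundamental hA hM h1 t s).continuousAt

/-- The dependence on the initial time follows from that on the final time, because `Φ(t,s)` is the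
inverse of `Φ(s,t)` and inversion is continuous at units. -/
theorem continuous_fundamental_right (hA : Continuous A) (hM : ∀ t, ‖A t‖ ≤ M)
    (h1 : ‖(1 : 𝔸)‖ ≤ 1) (t : ℝ) : Continuous fun s => fundamental A t s := by
  have hinv : ∀ s, fundamental A t s = Ring.inverse (fundamental A s t) := fun s =>
    (Ring.inverse_unit (⟨fundamental A s t, fundamental A t s, fundamental_mul_swap hA hM h1 s t,
      fundamental_mul_swap hA hM h1 t s⟩ : 𝔸ˣ)).symm
  simp only [hinv]
  refine continuous_iff_continuousAt.2 fun s => ?_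
  exact ContinuousAt.comp (f := fun s => fundamental A s t)
    (NormedRing.inverse_continuousAt (⟨fundamental A s t, fundamental A t s,
      fundamental_mul_swap hA hM h1 s t, fundamental_mul_swap hA hM h1 t s⟩ : 𝔸ˣ))
    (continuous_fundamental_left hA hM h1 t).continuousAt

end LinearODE

namespace Schwarz

variable {nx nu : ℕ}

/-! ### Quadratic forms -/

/-- The Loewner order contains symmetry of the difference. The coercivity assumptions thus also
supply the symmetry of `R`, `Q` and `Q_T`. -/
theorem smul_one_le_iff_inner {n : ℕ} {c : ℝ} {F : Vec n →L[ℝ] Vec n} :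
    c • (1 : Vec n →L[ℝ] Vec n) ≤ F ↔
      (∀ x y, inner ℝ (F x) y = inner ℝ x (F y)) ∧ ∀ x, c * ‖x‖ ^ 2 ≤ inner ℝ x (F x) := by
  rw [ContinuousLinearMap.le_def, ContinuousLinearMap.isPositive_iff]
  refine and_congr ⟨fun h x y => ?_, fun h x y => ?_⟩ (forall_congr' fun x => ?_)
  · have := h x y
    simp only [ContinuousLinearMap.coe_coe, sub_apply,
      smul_apply, one_apply_eq_self, inner_sub_left,
      inner_sub_right, real_inner_smul_left, real_inner_smul_right] at this
    linarith
  · have := h x y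
    simp only [ContinuousLinearMap.coe_coe, sub_apply,
      smul_apply, one_apply_eq_self, inner_sub_left,
      inner_sub_right, real_inner_smul_left, real_inner_smul_right]
    linarith
  · rw [real_inner_comm]
    simp only [sub_apply, smul_apply, one_apply_eq_self, inner_sub_right, real_inner_smul_right,
      real_inner_self_eq_norm_sq, sub_nonneg]

theorem inner_le_of_le_smul_one {n : ℕ} {c : ℝ} {F : Vec n →L[ℝ] Vec n}
    (h : F ≤ c • (1 : Vec n →L[ℝ] Vec n)) (x : Vec n) : inner ℝ x (F x) ≤ c * ‖x‖ ^ 2 := by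
  have := (ContinuousLinearMap.le_def _ _).1 h |>.inner_nonneg_left x
  simp only [sub_apply, smul_apply,
    one_apply_eq_self, inner_sub_left, real_inner_smul_left,
    real_inner_self_eq_norm_sq] at this
  rw [real_inner_comm]
  linarith

/-- A symmetric map with quadratic form between `0` and `c` is bounded by `c`. -/
theorem norm_apply_le_of_inner_le {n : ℕ} {c : ℝ} (hc : 0 < c) {F : Vec n →L[ℝ] Vec n}
    (hsymm : ∀ x y, inner ℝ (F x) y = inner ℝ x (F y)) (h0 : ∀ x, 0 ≤ inner ℝ x (F x))
    (h1 : ∀ x, inner ℝ x (F x) ≤ c * ‖x‖ ^ 2) (x : Vec n) : ‖F x‖ ≤ c * ‖x‖ := by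
  have e1 := h1 (F x)
  -- Nonnegativity of the form at `c x - F x`, with `⟨Fx, F(Fx)⟩ ≤ c ‖Fx‖²`, gives `‖Fx‖² ≤ c ⟨x,
  -- Fx⟩`.
  have e2 := h0 (c • x - F x)
  have e3 := h1 x
  have e4 : inner ℝ x (F (F x)) = ‖F x‖ ^ 2 := by
    rw [← hsymm, real_inner_self_eq_norm_sq]
  have e5 : inner ℝ (F x) (F x) = ‖F x‖ ^ 2 := real_inner_self_eq_norm_sq _
  simp only [map_sub, map_smul, inner_sub_left, inner_sub_right, real_inner_smul_left,
    real_inner_smul_right, e4, e5] at e2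
  have e6 : ‖F x‖ ^ 2 ≤ c * inner ℝ x (F x) := by
    refine le_of_mul_le_mul_left ?_ hc
    nlinarith
  refine le_of_sq_le_sq ?_ (by positivity)
  nlinarith

theorem exists_apply_eq_of_le_inner {n : ℕ} {c : ℝ} (hc : 0 < c) {F : Vec n →L[ℝ] Vec n}
    (h : ∀ x, c * ‖x‖ ^ 2 ≤ inner ℝ x (F x)) (y : Vec n) : ∃ x, F x = y := by
  have hinj : Function.Injective (F : Vec n →ₗ[ℝ] Vec n) := by
    rw [injective_iff_map_eq_zero]
    intro x hx
    have h1 := h x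
    have hx' : F x = 0 := hx
    rw [hx', inner_zero_right] at h1
    have : ‖x‖ ^ 2 = 0 := le_antisymm (by nlinarith [sq_nonneg ‖x‖]) (sq_nonneg _)
    simpa using this
  exact (LinearMap.injective_iff_surjective.1 hinj) y

theorem norm_le_of_le_inner {n : ℕ} {c : ℝ} (hc : 0 < c) {F : Vec n →L[ℝ] Vec n}
    (h : ∀ x, c * ‖x‖ ^ 2 ≤ inner ℝ x (F x)) (x : Vec n) : ‖x‖ ≤ ‖F x‖ / c := by
  rw [le_div_iff₀ hc]
  rcases eq_or_lt_of_le (norm_nonneg x) with h0 | h0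
  · rw [← h0]; simp
  · refine le_of_mul_le_mul_left ?_ h0
    have := (h x).trans (real_inner_le_norm x (F x))
    nlinarith

theorem isInvertible_of_injective {n : ℕ} {F : Vec n →L[ℝ] Vec n} (h : Function.Injective F) :
    F.IsInvertible :=
  ⟨(LinearEquiv.ofInjectiveEndo (F : Vec n →ₗ[ℝ] Vec n) h).toContinuousLinearEquiv, by
    ext x : 1; rfl⟩

theorem isInvertible_of_le_inner {n : ℕ} {c : ℝ} (hc : 0 < c) {F : Vec n →L[ℝ] Vec n}
    (h : ∀ x, c * ‖x‖ ^ 2 ≤ inner ℝ x (F x)) : F.IsInvertible := by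
  refine isInvertible_of_injective ((injective_iff_map_eq_zero F).2 fun x hx => ?_)
  have := norm_le_of_le_inner hc h x
  rw [hx, norm_zero, zero_div] at this
  exact norm_le_zero_iff.1 this

/-! ### Problems with globally continuous and bounded coefficients -/

/-- Coefficients that are continuous and satisfy the bounds of the assumptions on all of `ℝ`. -/
structure Regular (P : Problem nx nu) (K : Constants) : Prop where
  lamA_pos : 0 < K.lamA
  lamB_pos : 0 < K.lamB
  lamQ_pos : 0 < K.lamQ
  lamH_pos : 0 < K.lamH
  lamR_pos : 0 < K.lamR
  gamR_pos : 0 < K.gamR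
  gamQ_pos : 0 < K.gamQ
  contA : Continuous P.A
  contB : Continuous P.B
  contQ : Continuous P.Q
  contH : Continuous P.H
  contR : Continuous P.R
  normA : ∀ t, ‖P.A t‖ ≤ K.lamA
  normB : ∀ t, ‖P.B t‖ ≤ K.lamB
  normQ : ∀ t, ‖P.Q t‖ ≤ K.lamQ
  normH : ∀ t, ‖P.H t‖ ≤ K.lamH
  normR : ∀ t, ‖P.R t‖ ≤ K.lamR
  lowerR : ∀ t, K.gamR • (1 : Vec nu →L[ℝ] Vec nu) ≤ P.R t
  lowerQ : ∀ t, K.gamQ • (1 : Vec nx →L[ℝ] Vec nx) ≤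
    P.Q t - (P.H t).adjoint ∘L (P.R t).inverse ∘L P.H t

/-- The running cost `xᵀQx + 2uᵀHx + uᵀRu` at time `t`. -/
def stageCost (P : Problem nx nu) (t : ℝ) (x : Vec nx) (u : Vec nu) : ℝ :=
  inner ℝ x (P.Q t x) + 2 * inner ℝ u (P.H t x) + inner ℝ u (P.R t u)

/-- The polar form of the running cost. -/
def stagePolar (P : Problem nx nu) (t : ℝ) (x : Vec nx) (u : Vec nu) (y : Vec nx) (v : Vec nu) :
    ℝ :=
  inner ℝ y (P.Q t x + (P.H t).adjoint u) + inner ℝ v (P.H t x + P.R t u)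

/-- The control `u + R⁻¹Hx` of the system with drift `A - BR⁻¹H`. -/
def shifted (P : Problem nx nu) (t : ℝ) (x : Vec nx) (u : Vec nu) : Vec nu :=
  u + (P.R t).inverse (P.H t x)

namespace Regular

variable {P : Problem nx nu} {K : Constants}

theorem growth_pos (h : Regular P K) : 0 < K.growth := by
  have := h.lamA_pos; have := h.lamB_pos; have := h.lamH_pos; have := h.gamR_pos
  unfold Constants.growth
  positivity

theorem lamA_le_growth (h : Regular P K) : K.lamA ≤ K.growth := by
  have := h.lamB_pos; have := h.lamH_pos; have := h.gamR_pos
  unfold Constants.growth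
  have : 0 ≤ K.lamB * (K.lamH / K.gamR) := by positivity
  linarith

theorem inner_R_symm (h : Regular P K) (t : ℝ) (u v : Vec nu) :
    inner ℝ (P.R t u) v = inner ℝ u (P.R t v) :=
  (smul_one_le_iff_inner.1 (h.lowerR t)).1 u v

theorem le_inner_R (h : Regular P K) (t : ℝ) (u : Vec nu) :
    K.gamR * ‖u‖ ^ 2 ≤ inner ℝ u (P.R t u) :=
  (smul_one_le_iff_inner.1 (h.lowerR t)).2 u

theorem isInvertible_R (h : Regular P K) (t : ℝ) : (P.R t).IsInvertible :=
  isInvertible_of_le_inner h.gamR_pos (h.le_inner_R t)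

theorem R_inverse_apply (h : Regular P K) (t : ℝ) (u : Vec nu) :
    P.R t ((P.R t).inverse u) = u :=
  (h.isInvertible_R t).self_apply_inverse u

theorem norm_R_inverse_apply_le (h : Regular P K) (t : ℝ) (u : Vec nu) :
    ‖(P.R t).inverse u‖ ≤ ‖u‖ / K.gamR := by
  simpa only [h.R_inverse_apply] using
    norm_le_of_le_inner h.gamR_pos (h.le_inner_R t) ((P.R t).inverse u)

theorem continuous_R_inverse (h : Regular P K) : Continuous fun t => (P.R t).inverse :=
  continuous_iff_continuousAt.2 fun t =>
    ((h.isInvertible_R t).contDiffAt_map_inverse (n := 0)).continuousAt.comp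
      h.contR.continuousAt

theorem inner_R_inverse_symm (h : Regular P K) (t : ℝ) (u v : Vec nu) :
    inner ℝ ((P.R t).inverse u) v = inner ℝ u ((P.R t).inverse v) := by
  conv_lhs => rw [← h.R_inverse_apply t v, ← h.inner_R_symm, h.R_inverse_apply]

theorem inner_R_inverse_nonneg (h : Regular P K) (t : ℝ) (u : Vec nu) :
    0 ≤ inner ℝ u ((P.R t).inverse u) := by
  have := h.le_inner_R t ((P.R t).inverse u)
  rw [h.R_inverse_apply, real_inner_comm] at this
  exact (mul_nonneg h.gamR_pos.le (sq_nonneg _)).trans this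

/-- The lower bound makes `Q - HᵀR⁻¹H` symmetric, and `HᵀR⁻¹H` is symmetric because `R` is. -/
theorem inner_Q_symm (h : Regular P K) (t : ℝ) (x y : Vec nx) :
    inner ℝ (P.Q t x) y = inner ℝ x (P.Q t y) := by
  have := (smul_one_le_iff_inner.1 (h.lowerQ t)).1 x y
  simp only [sub_apply, ContinuousLinearMap.comp_apply, inner_sub_left,
    inner_sub_right, ContinuousLinearMap.adjoint_inner_left,
    ContinuousLinearMap.adjoint_inner_right, h.inner_R_inverse_symm] at this
  linarith

theorem le_inner_Q_sub (h : Regular P K) (t : ℝ) (x : Vec nx) :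
    K.gamQ * ‖x‖ ^ 2 ≤ inner ℝ x (P.Q t x) - inner ℝ (P.H t x) ((P.R t).inverse (P.H t x)) := by
  have := (smul_one_le_iff_inner.1 (h.lowerQ t)).2 x
  simpa only [sub_apply, ContinuousLinearMap.comp_apply, inner_sub_right,
    ContinuousLinearMap.adjoint_inner_right] using this

theorem le_inner_Q (h : Regular P K) (t : ℝ) (x : Vec nx) :
    K.gamQ * ‖x‖ ^ 2 ≤ inner ℝ x (P.Q t x) := by
  linarith [h.le_inner_Q_sub t x, h.inner_R_inverse_nonneg t (P.H t x)]

theorem inner_Q_le (h : Regular P K) (t : ℝ) (x : Vec nx) :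
    inner ℝ x (P.Q t x) ≤ K.lamQ * ‖x‖ ^ 2 := by
  refine (real_inner_le_norm _ _).trans ?_
  have := (P.Q t).le_of_opNorm_le (h.normQ t) x
  nlinarith [norm_nonneg x]

/-- Completing the square in `u`. The shifted control `u + R⁻¹Hx` decouples from the state, which
makes coercivity visible. -/
theorem stageCost_eq (h : Regular P K) (t : ℝ) (x : Vec nx) (u : Vec nu) :
    stageCost P t x u =
      (inner ℝ x (P.Q t x) - inner ℝ (P.H t x) ((P.R t).inverse (P.H t x))) +
        inner ℝ (shifted P t x u) (P.R t (shifted P t x u)) := by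
  unfold stageCost shifted
  have e1 : inner ℝ ((P.R t).inverse (P.H t x)) (P.R t u) = inner ℝ u (P.H t x) := by
    rw [← h.inner_R_symm, h.R_inverse_apply, real_inner_comm]
  simp only [map_add, inner_add_left, inner_add_right, h.R_inverse_apply, e1,
    real_inner_comm (P.H t x) ((P.R t).inverse (P.H t x))]
  ring

theorem le_stageCost (h : Regular P K) (t : ℝ) (x : Vec nx) (u : Vec nu) :
    K.gamQ * ‖x‖ ^ 2 + K.gamR * ‖shifted P t x u‖ ^ 2 ≤ stageCost P t x u := by
  rw [h.stageCost_eq]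
  exact add_le_add (h.le_inner_Q_sub t x) (h.le_inner_R t _)

theorem gamQ_le_stageCost (h : Regular P K) (t : ℝ) (x : Vec nx) (u : Vec nu) :
    K.gamQ * ‖x‖ ^ 2 ≤ stageCost P t x u :=
  (le_add_of_nonneg_right (mul_nonneg h.gamR_pos.le (sq_nonneg _))).trans (h.le_stageCost t x u)

theorem stageCost_nonneg (h : Regular P K) (t : ℝ) (x : Vec nx) (u : Vec nu) :
    0 ≤ stageCost P t x u :=
  (mul_nonneg h.gamQ_pos.le (sq_nonneg _)).trans (h.gamQ_le_stageCost t x u)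

theorem stageCost_le (h : Regular P K) (t : ℝ) (x : Vec nx) (u : Vec nu) :
    stageCost P t x u ≤ K.lamQ * ‖x‖ ^ 2 + K.lamR * ‖shifted P t x u‖ ^ 2 := by
  rw [h.stageCost_eq]
  refine add_le_add ?_ ?_
  · linarith [h.inner_Q_le t x, h.inner_R_inverse_nonneg t (P.H t x)]
  · refine (real_inner_le_norm _ _).trans ?_
    have := (P.R t).le_of_opNorm_le (h.normR t) (shifted P t x u)
    nlinarith [norm_nonneg (shifted P t x u)]

theorem norm_R_inverse_H_le (h : Regular P K) (t : ℝ) (x : Vec nx) :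
    ‖(P.R t).inverse (P.H t x)‖ ≤ K.lamH / K.gamR * ‖x‖ := by
  refine (h.norm_R_inverse_apply_le t _).trans ?_
  rw [div_mul_eq_mul_div]
  exact div_le_div_of_nonneg_right ((P.H t).le_of_opNorm_le (h.normH t) x) h.gamR_pos.le

theorem norm_shifted_sq_le (h : Regular P K) (t : ℝ) (x : Vec nx) (u : Vec nu) :
    ‖shifted P t x u‖ ^ 2 ≤ 2 * ‖u‖ ^ 2 + 2 * (K.lamH / K.gamR) ^ 2 * ‖x‖ ^ 2 := by
  have h1 : ‖shifted P t x u‖ ≤ ‖u‖ + K.lamH / K.gamR * ‖x‖ :=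
    (norm_add_le _ _).trans (by gcongr; exact h.norm_R_inverse_H_le t x)
  have h2 : ‖shifted P t x u‖ ^ 2 ≤ (‖u‖ + K.lamH / K.gamR * ‖x‖) ^ 2 := by gcongr
  nlinarith [sq_nonneg (‖u‖ - K.lamH / K.gamR * ‖x‖)]

/-- Since the left side is nonnegative, this is the convexity inequality used to compare an extremal
with other trajectories. -/
theorem stageCost_sub (h : Regular P K) (t : ℝ) (x y : Vec nx) (u v : Vec nu) :
    stageCost P t (y - x) (v - u) =
      stageCost P t y v - 2 * stagePolar P t x u y v + stageCost P t x u := by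
  unfold stageCost stagePolar
  simp only [map_sub, inner_sub_left, inner_sub_right, inner_add_right,
    ContinuousLinearMap.adjoint_inner_right, real_inner_comm u (P.H t y),
    ← h.inner_Q_symm t x y, real_inner_comm y (P.Q t x), ← h.inner_R_symm t u v,
    real_inner_comm v (P.R t u)]
  ring

theorem stagePolar_self (t : ℝ) (x : Vec nx) (u : Vec nu) :
    stagePolar P t x u x u = stageCost P t x u := by
  unfold stageCost stagePolar
  simp only [inner_add_right, ContinuousLinearMap.adjoint_inner_right,
    real_inner_comm u (P.H t x)]
  ring

end Regular

/-! ### Extension of the coefficients to the real line -/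

namespace Problem

/-- The problem with coefficients extended to `ℝ` by their values at the end points. -/
def extend (P : Problem nx nu) (hT : 0 ≤ P.T) : Problem nx nu where
  T := P.T
  A t := P.A (projIcc 0 P.T hT t)
  B t := P.B (projIcc 0 P.T hT t)
  Q t := P.Q (projIcc 0 P.T hT t)
  H t := P.H (projIcc 0 P.T hT t)
  R t := P.R (projIcc 0 P.T hT t)
  QT := P.QT
  x₀ := P.x₀

variable {P : Problem nx nu} {hT : 0 ≤ P.T} {t : ℝ}

theorem extend_A (ht : t ∈ Icc 0 P.T) : (P.extend hT).A t = P.A t := by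
  simp [extend, projIcc_of_mem hT ht]

theorem extend_B (ht : t ∈ Icc 0 P.T) : (P.extend hT).B t = P.B t := by
  simp [extend, projIcc_of_mem hT ht]

theorem extend_Q (ht : t ∈ Icc 0 P.T) : (P.extend hT).Q t = P.Q t := by
  simp [extend, projIcc_of_mem hT ht]

theorem extend_H (ht : t ∈ Icc 0 P.T) : (P.extend hT).H t = P.H t := by
  simp [extend, projIcc_of_mem hT ht]

theorem extend_R (ht : t ∈ Icc 0 P.T) : (P.extend hT).R t = P.R t := by
  simp [extend, projIcc_of_mem hT ht]

theorem regular_extend {K : Constants} (hbdd : BoundedMatrices P K) (hcoer : Coercive P K)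
    (hT : 0 ≤ P.T) : Regular (P.extend hT) K := by
  have hmem : ∀ t, (projIcc 0 P.T hT t : ℝ) ∈ Icc 0 P.T := fun t => (projIcc 0 P.T hT t).2
  have hcont : Continuous fun t => (projIcc 0 P.T hT t : ℝ) :=
    continuous_subtype_val.comp continuous_projIcc
  exact
    { lamA_pos := hbdd.lamA_pos
      lamB_pos := hbdd.lamB_pos
      lamQ_pos := hbdd.lamQ_pos
      lamH_pos := hbdd.lamH_pos
      lamR_pos := hbdd.lamR_pos
      gamR_pos := hcoer.gamR_pos
      gamQ_pos := hcoer.gamQ_pos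
      contA := hbdd.contA.comp_continuous hcont hmem
      contB := hbdd.contB.comp_continuous hcont hmem
      contQ := hbdd.contQ.comp_continuous hcont hmem
      contH := hbdd.contH.comp_continuous hcont hmem
      contR := hbdd.contR.comp_continuous hcont hmem
      normA := fun t => hbdd.normA _ (hmem t)
      normB := fun t => hbdd.normB _ (hmem t)
      normQ := fun t => hbdd.normQ _ (hmem t)
      normH := fun t => hbdd.normH _ (hmem t)
      normR := fun t => hbdd.normR _ (hmem t)
      lowerR := fun t => hcoer.lowerR _ (hmem t)
      lowerQ := fun t => hcoer.lowerQ _ (hmem t) }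

end Problem

/-! ### Locality: the assumptions and solutions depend on the coefficients only on `[0, T]`. -/

theorem peanoBaker_congr {n : ℕ} {A A' : ℝ → Vec n →L[ℝ] Vec n} {c d : ℝ}
    (h : EqOn A A' (Icc c d)) (i : ℕ) {t s : ℝ} (ht : t ∈ Icc c d) (hs : s ∈ Icc c d) :
    peanoBaker A i t s = peanoBaker A' i t s := by
  induction i generalizing t with
  | zero => rfl
  | succ i ih =>
    refine intervalIntegral.integral_congr fun r hr => ?_
    have hr' : r ∈ Icc c d := uIcc_subset_Icc hs ht hr
    simp only [h hr', ih hr']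

theorem evolution_congr {n : ℕ} {A A' : ℝ → Vec n →L[ℝ] Vec n} {c d : ℝ}
    (h : EqOn A A' (Icc c d)) {t s : ℝ} (ht : t ∈ Icc c d) (hs : s ∈ Icc c d) :
    evolution A t s = evolution A' t s :=
  tsum_congr fun i => peanoBaker_congr h i ht hs

theorem gramian_congr {n l : ℕ} {A A' : ℝ → Vec n →L[ℝ] Vec n} {B B' : ℝ → Vec l →L[ℝ] Vec n}
    {c d : ℝ} (hA : EqOn A A' (Icc c d)) (hB : EqOn B B' (Icc c d)) {t₀ t₁ : ℝ}
    (h₀ : t₀ ∈ Icc c d) (h₁ : t₁ ∈ Icc c d) : gramian A B t₀ t₁ = gramian A' B' t₀ t₁ := by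
  refine intervalIntegral.integral_congr fun r hr => ?_
  have hr' : r ∈ Icc c d := uIcc_subset_Icc h₀ h₁ hr
  simp only [hB hr', evolution_congr hA h₀ hr']

theorem peanoBaker_eq_seriesTerm {n : ℕ} (A : ℝ → Vec n →L[ℝ] Vec n) (i : ℕ) (t s : ℝ) :
    peanoBaker A i t s = LinearODE.seriesTerm A i t s := by
  induction i generalizing t with
  | zero => rfl
  | succ i ih => exact intervalIntegral.integral_congr fun r _ => by simp only [ih]; rfl

theorem evolution_eq_fundamental {n : ℕ} (A : ℝ → Vec n →L[ℝ] Vec n) (t s : ℝ) :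
    evolution A t s = LinearODE.fundamental A t s :=
  tsum_congr fun i => peanoBaker_eq_seriesTerm A i t s

theorem UniformlyControllable.extend {P : Problem nx nu} {K : Constants}
    (h : UniformlyControllable P K) (hT : 0 ≤ P.T) : UniformlyControllable (P.extend hT) K where
  σ_pos := h.σ_pos
  σ_lt := h.σ_lt
  α₀_pos := h.α₀_pos
  α₁_pos := h.α₁_pos
  β₀_pos := h.β₀_pos
  β₁_pos := h.β₁_pos
  bounds := by
    intro t₀ ht₀
    change t₀ ∈ Icc 0 (P.T - K.σ) at ht₀
    obtain ⟨t₁, ht₁, hb⟩ := h.bounds t₀ ht₀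
    have hσ := h.σ_pos
    have m₀ : t₀ ∈ Icc 0 P.T := ⟨ht₀.1, by linarith [ht₀.2]⟩
    have m₁ : t₁ ∈ Icc 0 P.T := ⟨ht₀.1.trans ht₁.1, by linarith [ht₁.2, ht₀.2]⟩
    have hA : EqOn (P.extend hT).A P.A (Icc 0 P.T) := fun t ht => Problem.extend_A ht
    have hB : EqOn (P.extend hT).B P.B (Icc 0 P.T) := fun t ht => Problem.extend_B ht
    refine ⟨t₁, ht₁, ?_⟩
    rwa [gramian_congr hA hB m₀ m₁, evolution_congr hA m₁ m₀]

theorem admissible_extend_iff {P : Problem nx nu} {hT : 0 ≤ P.T} {a b : ℝ} (ha : 0 ≤ a)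
    (hb : b ≤ P.T) {p : Vec nx} {x : ℝ → Vec nx} {u : ℝ → Vec nu} :
    Admissible (P.extend hT) a b p x u ↔ Admissible P a b p x u := by
  have key : ∀ t ∈ Icc a b, (∫ s in a..t, ((P.extend hT).A s (x s) + (P.extend hT).B s (u s))) =
      ∫ s in a..t, (P.A s (x s) + P.B s (u s)) := by
    refine fun t ht => intervalIntegral.integral_congr fun s hs => ?_
    rw [uIcc_of_le ht.1] at hs
    have hs' : s ∈ Icc 0 P.T := ⟨ha.trans hs.1, (hs.2.trans ht.2).trans hb⟩
    simp only [Problem.extend_A hs', Problem.extend_B hs']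
  constructor
  · rintro ⟨h1, h2, h3, h4⟩
    exact ⟨h1, h2, h3, fun t ht => by rw [← key t ht]; exact h4 t ht⟩
  · rintro ⟨h1, h2, h3, h4⟩
    exact ⟨h1, h2, h3, fun t ht => by rw [key t ht]; exact h4 t ht⟩

theorem cost_extend {P : Problem nx nu} {hT : 0 ≤ P.T} {a b : ℝ} (ha : 0 ≤ a) (hab : a ≤ b)
    (hb : b ≤ P.T) (L : Vec nx → ℝ) (x : ℝ → Vec nx) (u : ℝ → Vec nu) :
    cost (P.extend hT) a b L x u = cost P a b L x u := by
  unfold cost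
  congr 2
  refine intervalIntegral.integral_congr fun s hs => ?_
  rw [uIcc_of_le hab] at hs
  have hs' : s ∈ Icc 0 P.T := ⟨ha.trans hs.1, hs.2.trans hb⟩
  simp only [Problem.extend_Q hs', Problem.extend_H hs', Problem.extend_R hs']

theorem IsSolution.extend {P : Problem nx nu} {hT : 0 ≤ P.T} {a b : ℝ} (ha : 0 ≤ a) (hab : a ≤ b)
    (hb : b ≤ P.T) {p : Vec nx} {L : Vec nx → ℝ} {x : ℝ → Vec nx} {u : ℝ → Vec nu}
    {lam : ℝ → Vec nx} (h : IsSolution P a b p L x u lam) :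
    IsSolution (P.extend hT) a b p L x u lam where
  admissible := (admissible_extend_iff ha hb).2 h.admissible
  optimal x' u' h' := by
    rw [cost_extend ha hab hb, cost_extend ha hab hb]
    exact h.optimal x' u' ((admissible_extend_iff ha hb).1 h')
  continuous_control := h.continuous_control
  adjoint_eq t ht := by
    have ht' : t ∈ Icc 0 P.T := ⟨ha.trans ht.1, ht.2.trans hb⟩
    rw [Problem.extend_Q ht', Problem.extend_H ht', Problem.extend_A ht']
    exact h.adjoint_eq t ht
  adjoint_end := h.adjoint_end

end Schwarz

namespace Schwarz

variable {nx nu : ℕ} {P : Problem nx nu} {K : Constants}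

/-! ### Trajectories -/

namespace Regular

theorem norm_one_le (n : ℕ) : ‖(1 : Vec n →L[ℝ] Vec n)‖ ≤ 1 :=
  ContinuousLinearMap.norm_id_le

theorem hasDerivAt_evolution (h : Regular P K) (t s : ℝ) :
    HasDerivAt (fun t => evolution P.A t s) (P.A t ∘L evolution P.A t s) t := by
  simp only [evolution_eq_fundamental]
  exact LinearODE.hasDerivAt_fundamental h.contA h.normA (norm_one_le nx) t s

theorem evolution_self (s : ℝ) : evolution P.A s s = 1 := by
  rw [evolution_eq_fundamental, LinearODE.fundamental_self]

theorem evolution_comp_swap (h : Regular P K) (t s : ℝ) :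
    evolution P.A t s ∘L evolution P.A s t = 1 := by
  simp only [evolution_eq_fundamental]
  exact LinearODE.fundamental_mul_swap h.contA h.normA (norm_one_le nx) t s

theorem evolution_apply_swap (h : Regular P K) (t s : ℝ) (x : Vec nx) :
    evolution P.A t s (evolution P.A s t x) = x :=
  DFunLike.congr_fun (h.evolution_comp_swap t s) x

theorem norm_evolution_le (h : Regular P K) (t s : ℝ) :
    ‖evolution P.A t s‖ ≤ Real.exp (K.lamA * |t - s|) := by
  rw [evolution_eq_fundamental]
  exact LinearODE.norm_fundamental_le h.contA h.normA (norm_one_le nx) t s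

theorem continuous_evolution_right (h : Regular P K) (t : ℝ) :
    Continuous fun s => evolution P.A t s := by
  simp only [evolution_eq_fundamental]
  exact LinearODE.continuous_fundamental_right h.contA h.normA (norm_one_le nx) t

end Regular

/-- The state with initial value `p` at time `a` under the control `u`. -/
def response (P : Problem nx nu) (a : ℝ) (p : Vec nx) (u : ℝ → Vec nu) (t : ℝ) : Vec nx :=
  evolution P.A t a (p + ∫ s in a..t, evolution P.A a s (P.B s (u s)))

theorem response_self (a : ℝ) (p : Vec nx) (u : ℝ → Vec nu) : response P a p u a = p := by
  simp [response, Regular.evolution_self]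

/-- Variation of constants: `Φ(t,a)Φ(a,t) = I` cancels the evolution operators in the forcing term.
-/
theorem hasDerivAt_response (h : Regular P K) (a : ℝ) (p : Vec nx) {u : ℝ → Vec nu}
    (hu : Continuous u) (t : ℝ) :
    HasDerivAt (response P a p u) (P.A t (response P a p u t) + P.B t (u t)) t := by
  have hc : Continuous fun s => evolution P.A a s (P.B s (u s)) :=
    (h.continuous_evolution_right a).clm_apply (h.contB.clm_apply hu)
  have := (h.hasDerivAt_evolution t a).clm_apply
    ((hc.integral_hasStrictDerivAt a t).hasDerivAt.const_add p)
  simp only [h.evolution_apply_swap] at this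
  exact this

/-- `x` solves `ẋ = Ax + Bu` on `[a, b]` with continuous `u`. -/
structure IsTrajectory (P : Problem nx nu) (a b : ℝ) (x : ℝ → Vec nx) (u : ℝ → Vec nu) :
    Prop where
  control : ContinuousOn u (Icc a b)
  state : ∀ t ∈ Icc a b, HasDerivWithinAt x (P.A t (x t) + P.B t (u t)) (Icc a b) t

namespace IsTrajectory

variable {a b : ℝ} {x y : ℝ → Vec nx} {u v : ℝ → Vec nu}

theorem continuousOn (h : IsTrajectory P a b x u) : ContinuousOn x (Icc a b) :=
  fun t ht => (h.state t ht).continuousWithinAt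

theorem response (h : Regular P K) (a b : ℝ) (p : Vec nx) (hu : Continuous u) :
    IsTrajectory P a b (response P a p u) u :=
  ⟨hu.continuousOn, fun t _ => (hasDerivAt_response h a p hu t).hasDerivWithinAt⟩

theorem add_smul (hx : IsTrajectory P a b x u) (hy : IsTrajectory P a b y v) (c : ℝ) :
    IsTrajectory P a b (fun t => x t + c • y t) (fun t => u t + c • v t) where
  control := hx.control.add (hy.control.const_smul c)
  state t ht := by
    refine ((hx.state t ht).add ((hy.state t ht).const_smul c)).congr_deriv ?_
    simp only [map_add, map_smul, smul_add]
    abel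

theorem mono (hx : IsTrajectory P a b x u) {c d : ℝ} (hac : a ≤ c) (hdb : d ≤ b) :
    IsTrajectory P c d x u :=
  have hsub : Icc c d ⊆ Icc a b := Icc_subset_Icc hac hdb
  ⟨hx.control.mono hsub, fun t ht => (hx.state t (hsub ht)).mono hsub⟩

theorem continuousOn_rhs (h : Regular P K) (hx : ContinuousOn x (Icc a b))
    (hu : ContinuousOn u (Icc a b)) :
    ContinuousOn (fun t => P.A t (x t) + P.B t (u t)) (Icc a b) :=
  (h.contA.continuousOn.clm_apply hx).add (h.contB.continuousOn.clm_apply hu)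

theorem admissible (h : Regular P K) (hx : IsTrajectory P a b x u) :
    Admissible P a b (x a) x u where
  measurable_control := hx.control.aestronglyMeasurable measurableSet_Icc
  bounded_control := isCompact_Icc.exists_bound_of_continuousOn hx.control
  continuous_state := hx.continuousOn
  dynamics t ht := by
    have hx' := hx.mono le_rfl ht.2
    have hcont := continuousOn_rhs h hx'.continuousOn hx'.control
    rw [intervalIntegral.integral_eq_sub_of_hasDerivAt_of_le ht.1 hx'.continuousOn
      (fun s hs => (hx'.state s (Ioo_subset_Icc_self hs)).hasDerivAt (Icc_mem_nhds hs.1 hs.2))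
      (hcont.intervalIntegrable_of_Icc ht.1)]
    abel

end IsTrajectory

/-- Extending `f` by its end values makes it continuous on `ℝ` without changing the integrals, so
the end points need no separate treatment. -/
theorem hasDerivWithinAt_integral_Icc {E : Type*} [NormedAddCommGroup E] [NormedSpace ℝ E]
    [CompleteSpace E] {a b : ℝ} {f : ℝ → E} (hf : ContinuousOn f (Icc a b)) {t : ℝ}
    (ht : t ∈ Icc a b) :
    HasDerivWithinAt (fun t => ∫ s in a..t, f s) (f t) (Icc a b) t := by
  have hab : a ≤ b := ht.1.trans ht.2
  set g : ℝ → E := fun t => f (projIcc a b hab t) with hg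
  have hgc : Continuous g := hf.comp_continuous (continuous_subtype_val.comp continuous_projIcc)
    fun t => (projIcc a b hab t).2
  have hfg : ∀ s ∈ Icc a b, f s = g s := fun s hs => by simp [hg, projIcc_of_mem hab hs]
  have hint : ∀ s ∈ Icc a b, (∫ r in a..s, f r) = ∫ r in a..s, g r := fun s hs =>
    intervalIntegral.integral_congr fun r hr => by
      rw [uIcc_of_le hs.1] at hr
      exact hfg r ⟨hr.1, hr.2.trans hs.2⟩
  rw [hfg t ht]
  exact (hgc.integral_hasStrictDerivAt a t).hasDerivAt.hasDerivWithinAt.congr hint (hint t ht)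

theorem Admissible.isTrajectory {a b : ℝ} {p : Vec nx} {x : ℝ → Vec nx} {u : ℝ → Vec nu}
    (h : Regular P K) (hx : Admissible P a b p x u) (hu : ContinuousOn u (Icc a b)) :
    IsTrajectory P a b x u where
  control := hu
  state t ht := by
    refine HasDerivWithinAt.congr ?_ hx.dynamics (hx.dynamics t ht)
    exact (hasDerivWithinAt_integral_Icc
      (IsTrajectory.continuousOn_rhs h hx.continuous_state hu) ht).const_add p

theorem Admissible.initial {a b : ℝ} {p : Vec nx} {x : ℝ → Vec nx} {u : ℝ → Vec nu}
    (hx : Admissible P a b p x u) (hab : a ≤ b) : x a = p := by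
  simpa using hx.dynamics a ⟨le_rfl, hab⟩

/-! ### Extremals -/

/-- `(x, u, lam)` satisfies the state equation, the adjoint equation and the stationarity condition
on `[a, b]`. -/
structure IsExtremal (P : Problem nx nu) (a b : ℝ) (x : ℝ → Vec nx) (u : ℝ → Vec nu)
    (lam : ℝ → Vec nx) : Prop where
  trajectory : IsTrajectory P a b x u
  adjoint : ∀ t ∈ Icc a b, HasDerivWithinAt lam
    (-(P.Q t (x t) + (P.H t).adjoint (u t) + (P.A t).adjoint (lam t))) (Icc a b) t
  stationary : ∀ t ∈ Icc a b, P.R t (u t) + P.H t (x t) + (P.B t).adjoint (lam t) = 0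

/-- Derivative of the pairing of an adjoint state with a trajectory. -/
theorem hasDerivWithinAt_inner_adjoint {a b t : ℝ} {x y lam : ℝ → Vec nx} {u v : ℝ → Vec nu}
    (hlam : HasDerivWithinAt lam
      (-(P.Q t (x t) + (P.H t).adjoint (u t) + (P.A t).adjoint (lam t))) (Icc a b) t)
    (hy : HasDerivWithinAt y (P.A t (y t) + P.B t (v t)) (Icc a b) t) :
    HasDerivWithinAt (fun t => inner ℝ (lam t) (y t))
      (-stagePolar P t (x t) (u t) (y t) (v t) +
        inner ℝ (P.R t (u t) + P.H t (x t) + (P.B t).adjoint (lam t)) (v t)) (Icc a b) t := by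
  refine (hlam.inner ℝ hy).congr_deriv ?_
  unfold stagePolar
  simp only [inner_add_right, inner_add_left, inner_neg_left,
    ContinuousLinearMap.adjoint_inner_left, real_inner_comm (P.R t (u t)) (v t),
    real_inner_comm (P.H t (x t)) (v t), real_inner_comm (P.Q t (x t)) (y t),
    ContinuousLinearMap.adjoint_inner_right, real_inner_comm (u t) (P.H t (y t))]
  ring

theorem continuousOn_stageCost (h : Regular P K) {a b : ℝ} {x : ℝ → Vec nx} {u : ℝ → Vec nu}
    (hx : ContinuousOn x (Icc a b)) (hu : ContinuousOn u (Icc a b)) :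
    ContinuousOn (fun t => stageCost P t (x t) (u t)) (Icc a b) :=
  ((hx.inner (h.contQ.continuousOn.clm_apply hx)).add
    ((hu.inner (h.contH.continuousOn.clm_apply hx)).const_mul 2)).add
    (hu.inner (h.contR.continuousOn.clm_apply hu))

theorem continuous_adjoint_comp {n l : ℕ} {F : ℝ → Vec n →L[ℝ] Vec l} (hF : Continuous F) :
    Continuous fun t => (F t).adjoint :=
  (ContinuousLinearMap.adjoint : (Vec n →L[ℝ] Vec l) ≃ₗᵢ⋆[ℝ] _).continuous.comp hF

theorem continuousOn_stagePolar (h : Regular P K) {a b : ℝ} {x y : ℝ → Vec nx} {u v : ℝ → Vec nu}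
    (hx : ContinuousOn x (Icc a b)) (hu : ContinuousOn u (Icc a b))
    (hy : ContinuousOn y (Icc a b)) (hv : ContinuousOn v (Icc a b)) :
    ContinuousOn (fun t => stagePolar P t (x t) (u t) (y t) (v t)) (Icc a b) :=
  (hy.inner ((h.contQ.continuousOn.clm_apply hx).add
    ((continuous_adjoint_comp h.contH).continuousOn.clm_apply hu))).add
    (hv.inner ((h.contH.continuousOn.clm_apply hx).add (h.contR.continuousOn.clm_apply hu)))

theorem stageCost_add_smul (h : Regular P K) (t c : ℝ) (x y : Vec nx) (u v : Vec nu) :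
    stageCost P t (x + c • y) (u + c • v) =
      stageCost P t x u + 2 * c * stagePolar P t x u y v + c ^ 2 * stageCost P t y v := by
  unfold stageCost stagePolar
  simp only [map_add, map_smul, inner_add_left, inner_add_right, real_inner_smul_left,
    real_inner_smul_right, ContinuousLinearMap.adjoint_inner_right,
    real_inner_comm u (P.H t y), ← h.inner_Q_symm t x y, real_inner_comm y (P.Q t x),
    ← h.inner_R_symm t u v, real_inner_comm v (P.R t u)]
  ring

theorem cost_add_smul (h : Regular P K) {a b : ℝ} (hab : a ≤ b) (L : Vec nx → ℝ)
    {x y : ℝ → Vec nx} {u v : ℝ → Vec nu} (hx : IsTrajectory P a b x u)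
    (hy : IsTrajectory P a b y v) (c : ℝ) :
    cost P a b L (fun t => x t + c • y t) (fun t => u t + c • v t) =
      (1 / 2) * ((∫ t in a..b, stageCost P t (x t) (u t)) +
        2 * c * (∫ t in a..b, stagePolar P t (x t) (u t) (y t) (v t)) +
        c ^ 2 * ∫ t in a..b, stageCost P t (y t) (v t)) + L (x b + c • y b) := by
  have i1 := (continuousOn_stageCost h hx.continuousOn hx.control).intervalIntegrable_of_Icc
    (μ := volume) hab
  have i2 := (continuousOn_stagePolar h hx.continuousOn hx.control hy.continuousOn
    hy.control).intervalIntegrable_of_Icc (μ := volume) hab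
  have i3 := (continuousOn_stageCost h hy.continuousOn hy.control).intervalIntegrable_of_Icc
    (μ := volume) hab
  rw [← intervalIntegral.integral_const_mul, ← intervalIntegral.integral_const_mul,
    ← intervalIntegral.integral_add i1 (i2.const_mul _),
    ← intervalIntegral.integral_add (i1.add (i2.const_mul _)) (i3.const_mul _)]
  simp only [← stageCost_add_smul h]
  rfl

/-- First variation of the cost at an optimal pair. -/
theorem IsSolution.first_variation (h : Regular P K) {a b : ℝ} (hab : a ≤ b) {p : Vec nx}
    {L : Vec nx → ℝ} {x y : ℝ → Vec nx} {u v : ℝ → Vec nu} {lam : ℝ → Vec nx}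
    (hs : IsSolution P a b p L x u lam) (hy : IsTrajectory P a b y v) (hya : y a = 0) :
    (∫ t in a..b, stagePolar P t (x t) (u t) (y t) (v t)) + inner ℝ (lam b) (y b) = 0 := by
  have hx : IsTrajectory P a b x u := hs.admissible.isTrajectory h hs.continuous_control
  have hxa := hs.admissible.initial hab
  set J : ℝ → ℝ := fun c => cost P a b L (fun t => x t + c • y t) (fun t => u t + c • v t) with hJ
  -- As `y(a) = 0`, every perturbed pair has the same initial state and is admissible.
  have hmin : IsLocalMin J 0 := by
    refine Filter.Eventually.of_forall fun c => ?_
    have hadm := (hx.add_smul hy c).admissible h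
    simp only [hxa, hya, smul_zero, add_zero] at hadm
    simpa [hJ] using hs.optimal _ _ hadm
  have hL : HasDerivAt (fun c : ℝ => L (x b + c • y b)) (inner ℝ (lam b) (y b)) 0 := by
    have h1 : HasFDerivAt L (InnerProductSpace.toDual ℝ _ (lam b)) (x b + (0 : ℝ) • y b) := by
      simpa using hs.adjoint_end.hasFDerivAt
    have h2 : HasDerivAt (fun c : ℝ => x b + c • y b) (y b) 0 := by
      simpa using ((hasDerivAt_id (0 : ℝ)).smul_const (y b)).const_add (x b)
    have h3 := h1.comp_hasDerivAt (0 : ℝ) h2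
    rwa [InnerProductSpace.toDual_apply_apply] at h3
  set I0 := ∫ t in a..b, stageCost P t (x t) (u t)
  set I1 := ∫ t in a..b, stagePolar P t (x t) (u t) (y t) (v t)
  set I2 := ∫ t in a..b, stageCost P t (y t) (v t)
  have hd : HasDerivAt J (I1 + inner ℝ (lam b) (y b)) 0 := by
    have hJ' : J = fun c => (1 / 2) * (I0 + 2 * c * I1 + c ^ 2 * I2) + L (x b + c • y b) :=
      funext fun c => cost_add_smul h hab L hx hy c
    rw [hJ']
    refine HasDerivAt.add ?_ hL
    have h1 : HasDerivAt (fun c : ℝ => 2 * c * I1) (2 * I1) 0 := by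
      simpa using ((hasDerivAt_id (0 : ℝ)).const_mul 2).mul_const I1
    have h2 : HasDerivAt (fun c : ℝ => c ^ 2 * I2) 0 0 := by
      simpa using (hasDerivAt_pow 2 (0 : ℝ)).mul_const I2
    refine (((h1.const_add I0).add h2).const_mul (1 / 2 : ℝ)).congr_deriv ?_
    ring
  exact hmin.hasDerivAt_eq_zero hd

/-- Testing the first variation with the residual `e = Ru + Hx + Bᵀλ` itself as control direction
gives `∫ ‖e‖² = 0`; continuity of `e` and `a < b` then force `e = 0` everywhere. -/
theorem IsSolution.isExtremal (h : Regular P K) {a b : ℝ} (hab : a < b) {p : Vec nx}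
    {L : Vec nx → ℝ} {x : ℝ → Vec nx} {u : ℝ → Vec nu} {lam : ℝ → Vec nx}
    (hs : IsSolution P a b p L x u lam) : IsExtremal P a b x u lam := by
  have hx : IsTrajectory P a b x u := hs.admissible.isTrajectory h hs.continuous_control
  refine ⟨hx, hs.adjoint_eq, ?_⟩
  have hlam : ContinuousOn lam (Icc a b) := fun t ht => (hs.adjoint_eq t ht).continuousWithinAt
  set e : ℝ → Vec nu := fun t => P.R t (u t) + P.H t (x t) + (P.B t).adjoint (lam t) with he
  have hec : ContinuousOn e (Icc a b) :=
    ((h.contR.continuousOn.clm_apply hx.control).add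
      (h.contH.continuousOn.clm_apply hx.continuousOn)).add
      ((continuous_adjoint_comp h.contB).continuousOn.clm_apply hlam)
  set v : ℝ → Vec nu := fun t => e (projIcc a b hab.le t) with hv
  have hvc : Continuous v := hec.comp_continuous
    (continuous_subtype_val.comp continuous_projIcc) fun t => (projIcc a b hab.le t).2
  have hve : ∀ t ∈ Icc a b, v t = e t := fun t ht => by simp [hv, projIcc_of_mem hab.le ht]
  have hy := IsTrajectory.response h a b 0 hvc
  set y := response P a 0 v
  have hya : y a = 0 := response_self a 0 v
  have hvar := hs.first_variation h hab.le hy hya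
  have hpol := continuousOn_stagePolar h hx.continuousOn hx.control hy.continuousOn hy.control
  have hder : ∀ t ∈ Icc a b, HasDerivWithinAt (fun t => inner ℝ (lam t) (y t))
      (-stagePolar P t (x t) (u t) (y t) (v t) + ‖e t‖ ^ 2) (Icc a b) t := by
    intro t ht
    refine (hasDerivWithinAt_inner_adjoint (hs.adjoint_eq t ht) (hy.state t ht)).congr_deriv ?_
    rw [hve t ht, ← real_inner_self_eq_norm_sq]
  have hi1 := hpol.intervalIntegrable_of_Icc (μ := volume) hab.le
  have hi1' : IntervalIntegrable (fun t => -stagePolar P t (x t) (u t) (y t) (v t)) volume a b :=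
    hi1.neg
  have hi2 : IntervalIntegrable (fun t => ‖e t‖ ^ 2) volume a b :=
    (hec.norm.pow 2).intervalIntegrable_of_Icc hab.le
  have hftc := intervalIntegral.integral_eq_sub_of_hasDerivAt_of_le hab.le
    (fun t ht => (hder t ht).continuousWithinAt)
    (fun s hs => (hder s (Ioo_subset_Icc_self hs)).hasDerivAt (Icc_mem_nhds hs.1 hs.2))
    (hi1'.add hi2)
  rw [intervalIntegral.integral_add hi1' hi2, intervalIntegral.integral_neg, hya,
    inner_zero_right] at hftc
  have hzero : ∫ t in a..b, ‖e t‖ ^ 2 = 0 := by linarith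
  intro t ht
  by_contra hne
  have hpos := intervalIntegral.integral_pos hab (hec.norm.pow 2) (fun s _ => sq_nonneg ‖e s‖)
    ⟨t, ht, pow_pos (norm_pos_iff.2 hne) 2⟩
  exact hpos.ne' hzero

namespace IsExtremal

variable {a b : ℝ} {x y lam mu : ℝ → Vec nx} {u v : ℝ → Vec nu}

theorem mono (hx : IsExtremal P a b x u lam) {c d : ℝ} (hac : a ≤ c) (hdb : d ≤ b) :
    IsExtremal P c d x u lam :=
  have hsub : Icc c d ⊆ Icc a b := Icc_subset_Icc hac hdb
  ⟨hx.trajectory.mono hac hdb, fun t ht => (hx.adjoint t (hsub ht)).mono hsub,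
    fun t ht => hx.stationary t (hsub ht)⟩

/-- The three conditions are linear and homogeneous, and no boundary condition is included. Hence
errors are extremals. -/
theorem sub (hx : IsExtremal P a b x u lam) (hy : IsExtremal P a b y v mu) :
    IsExtremal P a b (fun t => x t - y t) (fun t => u t - v t) (fun t => lam t - mu t) where
  trajectory := by
    simpa only [neg_one_smul, ← sub_eq_add_neg] using hx.trajectory.add_smul hy.trajectory (-1)
  adjoint t ht := by
    refine ((hx.adjoint t ht).sub (hy.adjoint t ht)).congr_deriv ?_
    simp only [map_sub]
    abel
  stationary t ht := by
    have h1 := congrArg₂ (fun p q => p - q) (hx.stationary t ht) (hy.stationary t ht)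
    simp only [sub_zero] at h1
    rw [← h1]
    simp only [map_sub]
    abel

theorem control_eq (h : Regular P K) (hx : IsExtremal P a b x u lam) {t : ℝ} (ht : t ∈ Icc a b) :
    u t = -(P.R t).inverse (P.H t (x t) + (P.B t).adjoint (lam t)) := by
  have h1 := hx.stationary t ht
  rw [add_assoc, add_eq_zero_iff_eq_neg] at h1
  rw [← map_neg, ← h1, (h.isInvertible_R t).inverse_apply_self]

theorem hasDerivWithinAt_inner (hx : IsExtremal P a b x u lam) (hy : IsTrajectory P a b y v)
    {t : ℝ} (ht : t ∈ Icc a b) :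
    HasDerivWithinAt (fun t => inner ℝ (lam t) (y t))
      (-stagePolar P t (x t) (u t) (y t) (v t)) (Icc a b) t := by
  refine (hasDerivWithinAt_inner_adjoint (hx.adjoint t ht) (hy.state t ht)).congr_deriv ?_
  rw [hx.stationary t ht, inner_zero_left, add_zero]

/-- The value `V = ⟨λ, x⟩` dissipates at the rate of the running cost; it serves as Lyapunov
function. -/
theorem hasDerivWithinAt_inner_self (hx : IsExtremal P a b x u lam) {t : ℝ} (ht : t ∈ Icc a b) :
    HasDerivWithinAt (fun t => inner ℝ (lam t) (x t))
      (-stageCost P t (x t) (u t)) (Icc a b) t := by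
  rw [← Regular.stagePolar_self]
  exact hx.hasDerivWithinAt_inner hx.trajectory ht

end IsExtremal

end Schwarz

namespace Schwarz

variable {nx nu : ℕ} {P : Problem nx nu} {K : Constants}

/-! ### Bounds of the value function -/

theorem sub_le_sub_of_hasDerivWithinAt_le {c d : ℝ} (hcd : c ≤ d) {f g f' g' : ℝ → ℝ}
    (hf : ∀ s ∈ Icc c d, HasDerivWithinAt f (f' s) (Icc c d) s)
    (hg : ∀ s ∈ Icc c d, HasDerivWithinAt g (g' s) (Icc c d) s)
    (hle : ∀ s ∈ Icc c d, f' s ≤ g' s) : f d - f c ≤ g d - g c := by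
  have hmono : MonotoneOn (fun s => g s - f s) (Icc c d) := by
    refine monotoneOn_of_hasDerivWithinAt_nonneg (f' := fun s => g' s - f' s) (convex_Icc c d)
      (fun s hs => ((hg s hs).sub (hf s hs)).continuousWithinAt) (fun s hs => ?_) (fun s hs => ?_)
    · exact ((hg s (interior_subset hs)).sub (hf s (interior_subset hs))).mono interior_subset
    · exact sub_nonneg.2 (hle s (interior_subset hs))
  have := hmono (left_mem_Icc.2 hcd) (right_mem_Icc.2 hcd) hcd
  simp only at this
  linarith

/-- Symmetric terminal weights with quadratic form between `γ_Q` and `λ_Q`. -/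
structure TerminalWeight (K : Constants) (G : Vec nx →L[ℝ] Vec nx) : Prop where
  symm : ∀ x y, inner ℝ (G x) y = inner ℝ x (G y)
  lower : ∀ x, K.gamQ * ‖x‖ ^ 2 ≤ inner ℝ x (G x)
  upper : ∀ x, inner ℝ x (G x) ≤ K.lamQ * ‖x‖ ^ 2

namespace IsExtremal

variable {a b : ℝ} {x lam : ℝ → Vec nx} {u : ℝ → Vec nu} {G : Vec nx →L[ℝ] Vec nx}

theorem inner_antitone (h : Regular P K) (hx : IsExtremal P a b x u lam) {t e : ℝ} (hat : a ≤ t)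
    (hte : t ≤ e) (heb : e ≤ b) : inner ℝ (lam e) (x e) ≤ inner ℝ (lam t) (x t) := by
  have := sub_le_sub_of_hasDerivWithinAt_le hte
    (fun s hs => (hx.mono hat heb).hasDerivWithinAt_inner_self hs)
    (fun s _ => hasDerivWithinAt_const s (Icc t e) (0 : ℝ))
    (fun s _ => neg_nonpos.2 (h.stageCost_nonneg s (x s) (u s)))
  linarith

theorem le_inner_terminal (h : Regular P K) (hx : IsExtremal P a b x u lam)
    (hG : TerminalWeight K G) (hb : lam b = G (x b)) {t : ℝ} (ht : t ∈ Icc a b) :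
    K.gamQ * ‖x b‖ ^ 2 ≤ inner ℝ (lam t) (x t) := by
  refine le_trans ?_ (hx.inner_antitone h ht.1 ht.2 le_rfl)
  rw [hb, real_inner_comm]
  exact hG.lower _

theorem inner_nonneg (h : Regular P K) (hx : IsExtremal P a b x u lam)
    (hG : TerminalWeight K G) (hb : lam b = G (x b)) {t : ℝ} (ht : t ∈ Icc a b) :
    0 ≤ inner ℝ (lam t) (x t) :=
  (mul_nonneg h.gamQ_pos.le (sq_nonneg _)).trans (hx.le_inner_terminal h hG hb ht)

end IsExtremal

/-! #### Lower bound -/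

namespace Regular

theorem norm_drift_le (h : Regular P K) (t : ℝ) (x : Vec nx) :
    ‖P.A t x - P.B t ((P.R t).inverse (P.H t x))‖ ≤ K.growth * ‖x‖ := by
  have h1 := (P.A t).le_of_opNorm_le (h.normA t) x
  have h2 := (P.B t).le_of_opNorm_le (h.normB t) ((P.R t).inverse (P.H t x))
  have h3 := mul_le_mul_of_nonneg_left (h.norm_R_inverse_H_le t x) h.lamB_pos.le
  refine (norm_sub_le _ _).trans ?_
  unfold Constants.growth
  linarith

/-- A bound, uniform in `(x, u)`, for the Fenchel conjugate of the running cost: Young's inequality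
is applied separately to `x` and to the shifted control, the drift becoming `A - BR⁻¹H`. -/
theorem neg_two_mul_inner_sub_stageCost_le (h : Regular P K) (t : ℝ) (x mu nu' : Vec nx)
    (u : Vec nu) :
    -(2 * (inner ℝ nu' x + inner ℝ mu (P.A t x + P.B t u))) - stageCost P t x u ≤
      (‖nu'‖ + K.growth * ‖mu‖) ^ 2 / K.gamQ + (K.lamB * ‖mu‖) ^ 2 / K.gamR := by
  have hq := h.gamQ_pos
  have hr := h.gamR_pos
  set v := shifted P t x u with hv
  have hsplit : P.A t x + P.B t u =
      (P.A t x - P.B t ((P.R t).inverse (P.H t x))) + P.B t v := by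
    rw [hv, shifted, map_add]; abel
  have h1 : -(‖nu'‖ * ‖x‖) ≤ inner ℝ nu' x :=
    (abs_le.1 (abs_real_inner_le_norm nu' x)).1
  have h2 : -(‖mu‖ * (K.growth * ‖x‖)) ≤
      inner ℝ mu (P.A t x - P.B t ((P.R t).inverse (P.H t x))) :=
    (neg_le_neg (mul_le_mul_of_nonneg_left (h.norm_drift_le t x) (norm_nonneg mu))).trans
      (abs_le.1 (abs_real_inner_le_norm mu _)).1
  have h3 : -(‖mu‖ * (K.lamB * ‖v‖)) ≤ inner ℝ mu (P.B t v) :=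
    (neg_le_neg (mul_le_mul_of_nonneg_left ((P.B t).le_of_opNorm_le (h.normB t) v)
      (norm_nonneg mu))).trans (abs_le.1 (abs_real_inner_le_norm mu _)).1
  have h4 := h.le_stageCost t x u
  rw [← hv] at h4
  have young : ∀ {c : ℝ}, 0 < c → ∀ m z : ℝ, 2 * (m * z) - c * z ^ 2 ≤ m ^ 2 / c := by
    intro c hc m z
    rw [le_div_iff₀ hc]
    nlinarith [sq_nonneg (m - c * z)]
  have y1 := young hq (‖nu'‖ + K.growth * ‖mu‖) ‖x‖
  have y2 := young hr (K.lamB * ‖mu‖) ‖v‖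
  rw [hsplit, inner_add_right]
  linarith

end Regular

/-- Weak duality with the affine test arc `μ(s) = q + (s - t) ν'`: the derivative of `⟨λ, x⟩ - 2⟨μ,
x⟩` is bounded by the conjugate of the running cost, independently of the state. -/
theorem IsExtremal.dual_estimate (h : Regular P K) {a b : ℝ} {x lam : ℝ → Vec nx}
    {u : ℝ → Vec nu} (hx : IsExtremal P a b x u lam) {t e : ℝ} (hat : a ≤ t) (hte : t ≤ e)
    (heb : e ≤ b) {q nu' : Vec nx} {m : ℝ} (hm : ∀ s ∈ Icc t e, ‖q + (s - t) • nu'‖ ≤ m) :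
    inner ℝ (lam e) (x e) - 2 * inner ℝ (q + (e - t) • nu') (x e) + 2 * inner ℝ q (x t) -
      ((‖nu'‖ + K.growth * m) ^ 2 / K.gamQ + (K.lamB * m) ^ 2 / K.gamR) * (e - t) ≤
      inner ℝ (lam t) (x t) := by
  have hx' := hx.mono hat heb
  have hg := h.growth_pos
  have hB := h.lamB_pos
  have hq := h.gamQ_pos
  have hr := h.gamR_pos
  have hmu : ∀ s, HasDerivWithinAt (fun s => q + (s - t) • nu') nu' (Icc t e) s := fun s => by
    simpa using ((((hasDerivAt_id s).sub_const t).smul_const nu').const_add q).hasDerivWithinAt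
  set N := (‖nu'‖ + K.growth * m) ^ 2 / K.gamQ + (K.lamB * m) ^ 2 / K.gamR with hN
  have key := sub_le_sub_of_hasDerivWithinAt_le hte
    (fun s hs => (hx'.hasDerivWithinAt_inner_self hs).sub
      (((hmu s).inner ℝ (hx'.trajectory.state s hs)).const_mul 2))
    (fun s _ => ((hasDerivWithinAt_id s (Icc t e)).const_mul N)) (fun s hs => by
      have h1 := h.neg_two_mul_inner_sub_stageCost_le s (x s) (q + (s - t) • nu') nu' (u s)
      have h2 := hm s hs
      have h3 : (‖nu'‖ + K.growth * ‖q + (s - t) • nu'‖) ^ 2 / K.gamQ +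
          (K.lamB * ‖q + (s - t) • nu'‖) ^ 2 / K.gamR ≤ N := by rw [hN]; gcongr
      rw [mul_one]
      linarith)
  simp only [Pi.sub_apply, sub_self, zero_smul, add_zero, id] at key
  linarith

/-! ### Comparison of the duality constants with `c₀`. -/

theorem one_add_sq_le_exp {z : ℝ} (hz : 0 ≤ z) : (1 + z) ^ 2 ≤ Real.exp (2 * z) := by
  have := Real.add_one_le_exp z
  rw [two_mul, Real.exp_add, ← sq]
  gcongr
  linarith

theorem sq_one_sub_exp_neg_le {z : ℝ} (hz : 0 ≤ z) : (1 - Real.exp (-z)) ^ 2 ≤ z := by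
  have h1 := Real.add_one_le_exp (-z)
  have h2 := Real.exp_pos (-z)
  have h3 : Real.exp (-z) ≤ 1 := Real.exp_le_one_iff.2 (by linarith)
  nlinarith

namespace Regular

theorem dualα₀_pos (h : Regular P K) (hσ : 0 < K.σ) : 0 < K.dualα₀ := by
  have hg := h.growth_pos
  have : Real.exp (-2 * K.growth * K.σ) < 1 := Real.exp_lt_one_iff.2 (by nlinarith [mul_pos hg hσ])
  unfold Constants.dualα₀
  exact div_pos (by linarith) (by positivity)

theorem dualα₁_nonneg (h : Regular P K) (hσ : 0 < K.σ) : 0 ≤ K.dualα₁ := by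
  have hg := h.growth_pos
  have : 1 ≤ Real.exp (2 * K.growth * K.σ) := Real.one_le_exp (by positivity)
  unfold Constants.dualα₁
  exact div_nonneg (by linarith) (by positivity)

theorem c₀_pos (h : Regular P K) (hσ : 0 < K.σ) : 0 < K.c₀ := by
  have hg := h.growth_pos
  have := h.lamB_pos
  have := h.gamR_pos
  have := h.gamQ_pos
  have := h.dualα₀_pos hσ
  have := h.dualα₁_nonneg hσ
  unfold Constants.c₀
  refine mul_pos (lt_min ?_ ?_) (Real.exp_pos _) <;> positivity

/-- Uses the first entry of the minimum in `c₀`; the factor `(1 + α̃₁/α̃₀)²` is at least `1` and is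
given away. -/
theorem c₀_mul_le_one_left (h : Regular P K) (hσ : 0 < K.σ) {y : ℝ}
    (hy : y ≤ (K.lamB ^ 2 / K.gamR + 1 / (K.gamQ * K.dualα₀ ^ 2)) *
      Real.exp (2 * (K.growth * K.σ)) / (2 * K.growth)) : K.c₀ * y ≤ 1 := by
  have hg := h.growth_pos
  have := h.lamB_pos
  have := h.gamR_pos
  have := h.gamQ_pos
  have := h.dualα₀_pos hσ
  have := h.dualα₁_nonneg hσ
  set D := K.lamB ^ 2 / K.gamR * (1 + K.dualα₁ / K.dualα₀) ^ 2 + 1 / (K.gamQ * K.dualα₀ ^ 2)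
    with hD
  have hDpos : 0 < D := by positivity
  have hc : K.c₀ ≤ 2 * K.growth * D⁻¹ * Real.exp (-2 * K.growth * K.σ) := by
    unfold Constants.c₀
    gcongr
    exact min_le_left _ _
  have hy' : y ≤ D * Real.exp (2 * (K.growth * K.σ)) / (2 * K.growth) := by
    refine hy.trans ?_
    rw [hD]
    gcongr
    refine le_mul_of_one_le_right (by positivity) ?_
    have : 0 ≤ K.dualα₁ / K.dualα₀ := by positivity
    nlinarith
  calc K.c₀ * y ≤ K.c₀ * (D * Real.exp (2 * (K.growth * K.σ)) / (2 * K.growth)) := by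
        gcongr; exact (h.c₀_pos hσ).le
    _ ≤ 2 * K.growth * D⁻¹ * Real.exp (-2 * K.growth * K.σ) *
        (D * Real.exp (2 * (K.growth * K.σ)) / (2 * K.growth)) := by gcongr
    _ = Real.exp (-2 * K.growth * K.σ) * Real.exp (2 * (K.growth * K.σ)) := by field_simp
    _ = 1 := by rw [← Real.exp_add]; ring_nf; exact Real.exp_zero

theorem c₀_mul_le_one_right (h : Regular P K) (hσ : 0 < K.σ) {y : ℝ}
    (hy : y ≤ (K.lamB ^ 2 / (2 * K.gamR * K.growth) + 1 / K.gamQ) *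
      Real.exp (2 * (K.growth * K.σ))) : K.c₀ * y ≤ 1 := by
  have hg := h.growth_pos
  have := h.lamB_pos
  have := h.gamR_pos
  have := h.gamQ_pos
  set D := K.lamB ^ 2 / (2 * K.gamR * K.growth) + 1 / K.gamQ with hD
  have hDpos : 0 < D := by positivity
  have hc : K.c₀ ≤ D⁻¹ * Real.exp (-2 * K.growth * K.σ) := by
    unfold Constants.c₀
    gcongr
    exact min_le_right _ _
  calc K.c₀ * y ≤ K.c₀ * (D * Real.exp (2 * (K.growth * K.σ))) := by
        gcongr; exact (h.c₀_pos hσ).le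
    _ ≤ D⁻¹ * Real.exp (-2 * K.growth * K.σ) * (D * Real.exp (2 * (K.growth * K.σ))) := by gcongr
    _ = Real.exp (-2 * K.growth * K.σ) * Real.exp (2 * (K.growth * K.σ)) := by field_simp
    _ = 1 := by rw [← Real.exp_add]; ring_nf; exact Real.exp_zero

theorem σ_le_exp_div (h : Regular P K) :
    K.σ ≤ Real.exp (2 * (K.growth * K.σ)) / (2 * K.growth) := by
  have hg := h.growth_pos
  rw [le_div_iff₀ (by positivity)]
  linarith [Real.add_one_le_exp (2 * (K.growth * K.σ))]

/-- Equivalent to `2a α̃₀² ≤ σ`, which is `(1 - e^{-z})² ≤ z` at `z = 2aσ`. -/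
theorem exp_div_σ_le (h : Regular P K) (hσ : 0 < K.σ) :
    Real.exp (2 * (K.growth * K.σ)) / K.σ ≤
      1 / K.dualα₀ ^ 2 * Real.exp (2 * (K.growth * K.σ)) / (2 * K.growth) := by
  have hg := h.growth_pos
  have hα := h.dualα₀_pos hσ
  have hw : (2 * K.growth * K.dualα₀) ^ 2 ≤ 2 * (K.growth * K.σ) := by
    have h1 := sq_one_sub_exp_neg_le (z := 2 * (K.growth * K.σ)) (by positivity)
    have h2 : 2 * K.growth * K.dualα₀ = 1 - Real.exp (-(2 * (K.growth * K.σ))) := by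
      unfold Constants.dualα₀
      field_simp
    rwa [h2]
  have hw' : K.dualα₀ ^ 2 * (2 * K.growth) ≤ K.σ := by
    refine le_of_mul_le_mul_left ?_ (show 0 < 2 * K.growth by positivity)
    nlinarith
  calc Real.exp (2 * (K.growth * K.σ)) / K.σ
      ≤ Real.exp (2 * (K.growth * K.σ)) / (K.dualα₀ ^ 2 * (2 * K.growth)) := by gcongr
    _ = _ := by field_simp

theorem c₀_mul_interior_le_one (h : Regular P K) (hσ : 0 < K.σ) :
    K.c₀ * (((1 / K.σ + K.growth) ^ 2 / K.gamQ + K.lamB ^ 2 / K.gamR) * K.σ) ≤ 1 := by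
  have hg := h.growth_pos
  have hr := h.gamR_pos
  have hq := h.gamQ_pos
  refine h.c₀_mul_le_one_left hσ ?_
  set E := Real.exp (2 * (K.growth * K.σ)) with hE
  have h1 : K.lamB ^ 2 / K.gamR * K.σ ≤ K.lamB ^ 2 / K.gamR * (E / (2 * K.growth)) := by
    gcongr; exact h.σ_le_exp_div
  have h2 : (1 / K.σ + K.growth) ^ 2 * K.σ ≤ 1 / K.dualα₀ ^ 2 * E / (2 * K.growth) := by
    refine le_trans ?_ (h.exp_div_σ_le hσ)
    rw [le_div_iff₀ hσ]
    have := one_add_sq_le_exp (mul_pos hg hσ).le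
    calc (1 / K.σ + K.growth) ^ 2 * K.σ * K.σ = (1 + K.growth * K.σ) ^ 2 := by field_simp
      _ ≤ _ := this
  have h3 := div_le_div_of_nonneg_right h2 hq.le
  have e1 : 1 / K.dualα₀ ^ 2 * E / (2 * K.growth) / K.gamQ =
      1 / (K.gamQ * K.dualα₀ ^ 2) * E / (2 * K.growth) := by
    have := h.dualα₀_pos hσ
    field_simp
  rw [e1] at h3
  calc _ = (1 / K.σ + K.growth) ^ 2 * K.σ / K.gamQ + K.lamB ^ 2 / K.gamR * K.σ := by ring
    _ ≤ 1 / (K.gamQ * K.dualα₀ ^ 2) * E / (2 * K.growth) +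
        K.lamB ^ 2 / K.gamR * (E / (2 * K.growth)) := add_le_add h3 h1
    _ = _ := by ring

theorem c₀_mul_terminal_le_one (h : Regular P K) (hσ : 0 < K.σ) :
    K.c₀ * ((K.growth ^ 2 / K.gamQ + K.lamB ^ 2 / K.gamR) * K.σ + 1 / K.gamQ) ≤ 1 := by
  have hg := h.growth_pos
  have hr := h.gamR_pos
  have hq := h.gamQ_pos
  have hα := h.dualα₀_pos hσ
  set E := Real.exp (2 * (K.growth * K.σ)) with hE
  have hz : 0 < K.growth * K.σ := mul_pos hg hσ
  have hE1 : 2 * (K.growth * K.σ) + 1 ≤ E := Real.add_one_le_exp _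
  have h1 : K.lamB ^ 2 / K.gamR * K.σ ≤ K.lamB ^ 2 / K.gamR * (E / (2 * K.growth)) := by
    gcongr; exact h.σ_le_exp_div
  -- The target is `a²σ + 1` against an exponential. For `a ≥ 1/2`, `2a α̃₀ ≤ 1` makes the first
  -- entry of the minimum suffice; for `a ≤ 1/2`, `a²σ + 1 ≤ e^{2aσ}` suits the second.
  rcases le_total (1 / 2) K.growth with hcase | hcase
  · refine h.c₀_mul_le_one_left hσ ?_
    have hα1 : 2 * K.growth * K.dualα₀ ≤ 1 := by
      unfold Constants.dualα₀
      field_simp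
      linarith [Real.exp_pos (-(2 * K.growth * K.σ))]
    have h2 : K.growth ^ 2 * K.σ + 1 ≤ 1 / K.dualα₀ ^ 2 * E / (2 * K.growth) := by
      have h4 : 2 * K.growth * E ≤ 1 / K.dualα₀ ^ 2 * E / (2 * K.growth) := by
        rw [le_div_iff₀ (by positivity), one_div_mul_eq_div, le_div_iff₀ (by positivity)]
        have : (2 * K.growth * K.dualα₀) ^ 2 ≤ 1 := by
          rw [sq_le_one_iff₀ (by positivity)]; exact hα1
        have hE0 : 0 < E := Real.exp_pos _
        nlinarith
      refine le_trans ?_ h4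
      nlinarith
    have h3 := div_le_div_of_nonneg_right h2 hq.le
    have e1 : 1 / K.dualα₀ ^ 2 * E / (2 * K.growth) / K.gamQ =
        1 / (K.gamQ * K.dualα₀ ^ 2) * E / (2 * K.growth) := by
      field_simp
    rw [e1] at h3
    calc _ = (K.growth ^ 2 * K.σ + 1) / K.gamQ + K.lamB ^ 2 / K.gamR * K.σ := by ring
      _ ≤ 1 / (K.gamQ * K.dualα₀ ^ 2) * E / (2 * K.growth) +
          K.lamB ^ 2 / K.gamR * (E / (2 * K.growth)) := add_le_add h3 h1
      _ = _ := by ring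
  · refine h.c₀_mul_le_one_right hσ ?_
    have h2 : K.growth ^ 2 * K.σ + 1 ≤ E := by nlinarith
    have h3 := div_le_div_of_nonneg_right h2 hq.le
    calc _ = (K.growth ^ 2 * K.σ + 1) / K.gamQ + K.lamB ^ 2 / K.gamR * K.σ := by ring
      _ ≤ E / K.gamQ + K.lamB ^ 2 / K.gamR * (E / (2 * K.growth)) := add_le_add h3 h1
      _ = _ := by rw [← hE]; field_simp; ring

end Regular

/-- With a test arc starting at `c₀ x(t)`, duality yields `V(t) ≥ 2c₀‖x(t)‖² - c₀² C ‖x(t)‖²`, and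
`c₀ C ≤ 1`. -/
theorem IsExtremal.c₀_mul_le_inner (h : Regular P K) (hσ : 0 < K.σ) {a b : ℝ}
    {x lam : ℝ → Vec nx} {u : ℝ → Vec nu} {G : Vec nx →L[ℝ] Vec nx}
    (hx : IsExtremal P a b x u lam) (hG : TerminalWeight K G) (hb : lam b = G (x b)) {t : ℝ}
    (ht : t ∈ Icc a b) : K.c₀ * ‖x t‖ ^ 2 ≤ inner ℝ (lam t) (x t) := by
  have hc := h.c₀_pos hσ
  have hg := h.growth_pos
  have hq := h.gamQ_pos
  have hr := h.gamR_pos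
  have hB := h.lamB_pos
  have hself : inner ℝ (K.c₀ • x t) (x t) = K.c₀ * ‖x t‖ ^ 2 := by
    rw [real_inner_smul_left, real_inner_self_eq_norm_sq]
  rcases le_total (t + K.σ) b with hcase | hcase
  -- Room of length `σ` remains: the arc falls linearly to `0` at `t + σ`, so the end term reduces
  -- to `V(t + σ) ≥ 0`.
  · have key := hx.dual_estimate h ht.1 (by linarith : t ≤ t + K.σ) hcase
      (q := K.c₀ • x t) (nu' := -((1 / K.σ) • K.c₀ • x t)) (m := K.c₀ * ‖x t‖) (by
        intro s hs
        have e1 : K.c₀ • x t + (s - t) • -((1 / K.σ) • K.c₀ • x t) =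
            (1 - (s - t) / K.σ) • K.c₀ • x t := by
          module
        have h1 : 0 ≤ (s - t) / K.σ := div_nonneg (by linarith [hs.1]) hσ.le
        have h2 : (s - t) / K.σ ≤ 1 := (div_le_one hσ).2 (by linarith [hs.2])
        rw [e1, norm_smul, norm_smul, Real.norm_of_nonneg hc.le, Real.norm_eq_abs,
          abs_of_nonneg (by linarith)]
        exact mul_le_of_le_one_left (by positivity) (by linarith))
    have hV := hx.inner_nonneg h hG hb (t := t + K.σ) ⟨by linarith [ht.1], hcase⟩
    have e2 : K.c₀ • x t + (t + K.σ - t) • -((1 / K.σ) • K.c₀ • x t) = 0 := by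
      rw [add_sub_cancel_left, smul_neg, smul_smul, mul_one_div_cancel hσ.ne', one_smul,
        add_neg_cancel]
    have e3 : ‖-((1 / K.σ) • K.c₀ • x t)‖ = 1 / K.σ * (K.c₀ * ‖x t‖) := by
      rw [norm_neg, norm_smul, norm_smul, Real.norm_of_nonneg hc.le,
        Real.norm_of_nonneg (by positivity)]
    rw [e2, e3, inner_zero_left, hself, add_sub_cancel_left] at key
    have hN := mul_le_mul_of_nonneg_right (h.c₀_mul_interior_le_one hσ)
      (show 0 ≤ K.c₀ * ‖x t‖ ^ 2 by positivity)
    have e4 : ((1 / K.σ * (K.c₀ * ‖x t‖) + K.growth * (K.c₀ * ‖x t‖)) ^ 2 / K.gamQ +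
        (K.lamB * (K.c₀ * ‖x t‖)) ^ 2 / K.gamR) * K.σ =
        K.c₀ * (((1 / K.σ + K.growth) ^ 2 / K.gamQ + K.lamB ^ 2 / K.gamR) * K.σ) *
          (K.c₀ * ‖x t‖ ^ 2) := by ring
    rw [e4] at key
    linarith
  -- Near the right end the arc stays constant, and the terminal weight absorbs its end term at cost
  -- `‖μ‖² / γ_Q`.
  · have key := hx.dual_estimate h ht.1 ht.2 le_rfl (q := K.c₀ • x t) (nu' := 0)
      (m := K.c₀ * ‖x t‖) (by
        intro s _
        rw [smul_zero, add_zero, norm_smul, Real.norm_of_nonneg hc.le])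
    have hend : -(1 / K.gamQ * (K.c₀ * ‖x t‖) ^ 2) ≤
        inner ℝ (lam b) (x b) - 2 * inner ℝ (K.c₀ • x t) (x b) := by
      have h1 := hG.lower (x b)
      rw [real_inner_comm, ← hb] at h1
      have h2 := real_inner_le_norm (K.c₀ • x t) (x b)
      rw [norm_smul, Real.norm_of_nonneg hc.le] at h2
      have h3 : 1 / K.gamQ * (K.c₀ * ‖x t‖) ^ 2 - 2 * (K.c₀ * ‖x t‖ * ‖x b‖) +
          K.gamQ * ‖x b‖ ^ 2 = 1 / K.gamQ * (K.c₀ * ‖x t‖ - K.gamQ * ‖x b‖) ^ 2 := by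
        field_simp
        ring
      have h4 : 0 ≤ 1 / K.gamQ * (K.c₀ * ‖x t‖ - K.gamQ * ‖x b‖) ^ 2 := by positivity
      linarith
    rw [smul_zero, add_zero, norm_zero, zero_add, hself] at key
    have hN := mul_le_mul_of_nonneg_right (h.c₀_mul_terminal_le_one hσ)
      (show 0 ≤ K.c₀ * ‖x t‖ ^ 2 by positivity)
    have h5 : ((K.growth * (K.c₀ * ‖x t‖)) ^ 2 / K.gamQ +
        (K.lamB * (K.c₀ * ‖x t‖)) ^ 2 / K.gamR) * (b - t) ≤
        ((K.growth * (K.c₀ * ‖x t‖)) ^ 2 / K.gamQ +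
        (K.lamB * (K.c₀ * ‖x t‖)) ^ 2 / K.gamR) * K.σ := by
      gcongr
      linarith
    have e4 : ((K.growth * (K.c₀ * ‖x t‖)) ^ 2 / K.gamQ +
        (K.lamB * (K.c₀ * ‖x t‖)) ^ 2 / K.gamR) * K.σ + 1 / K.gamQ * (K.c₀ * ‖x t‖) ^ 2 =
        K.c₀ * ((K.growth ^ 2 / K.gamQ + K.lamB ^ 2 / K.gamR) * K.σ + 1 / K.gamQ) *
          (K.c₀ * ‖x t‖ ^ 2) := by ring
    linarith

end Schwarz

namespace Schwarz

variable {nx nu : ℕ} {P : Problem nx nu} {K : Constants}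

/-! #### Upper bound -/

/-- Convexity bounds the derivative of `⟨λ, x⟩ - 2⟨λ, y⟩` by the running cost of the competitor `y`;
the function `g` is any antiderivative of an upper bound of that cost. -/
theorem IsExtremal.inner_le_of_trajectory (h : Regular P K) {a b : ℝ} {x lam y : ℝ → Vec nx}
    {u v : ℝ → Vec nu} (hx : IsExtremal P a b x u lam) {t e : ℝ} (hat : a ≤ t) (hte : t ≤ e)
    (heb : e ≤ b) (hy : IsTrajectory P t e y v) (hyt : y t = x t) {g g' : ℝ → ℝ}
    (hg : ∀ s ∈ Icc t e, HasDerivWithinAt g (g' s) (Icc t e) s)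
    (hle : ∀ s ∈ Icc t e, stageCost P s (y s) (v s) ≤ g' s) :
    inner ℝ (lam t) (x t) ≤
      2 * inner ℝ (lam e) (y e) - inner ℝ (lam e) (x e) + (g e - g t) := by
  have hx' := hx.mono hat heb
  have key := sub_le_sub_of_hasDerivWithinAt_le hte
    (fun s hs => (hx'.hasDerivWithinAt_inner_self hs).sub
      ((hx'.hasDerivWithinAt_inner hy hs).const_mul 2)) hg (fun s hs => by
      have h1 := h.stageCost_nonneg s (y s - x s) (v s - u s)
      rw [h.stageCost_sub] at h1
      linarith [hle s hs])
  simp only [Pi.sub_apply, hyt] at key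
  linarith

/-! ### Comparison of the costs of test trajectories with `c₁`. -/

namespace Regular

theorem lamQ_le (h : Regular P K) : K.lamQ ≤ K.lamQ + K.lamH ^ 2 / K.gamR :=
  le_add_of_nonneg_right (div_nonneg (sq_nonneg _) h.gamR_pos.le)

theorem α₁'_pos (h : Regular P K) (hσ : 0 < K.σ) : 0 < K.α₁' := by
  have hg := h.growth_pos
  have hB := h.lamB_pos
  have : 1 < Real.exp (2 * K.σ * K.growth) := Real.one_lt_exp_iff.2 (by positivity)
  unfold Constants.α₁'
  exact div_pos (mul_pos (by positivity) (by linarith)) (by positivity)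

theorem α₀'_inv_nonneg (h : Regular P K) (hc : UniformlyControllable P K) :
    0 ≤ (K.lamH / K.gamR) ^ 2 / K.lamA * (1 + K.α₁ / K.α₀) ^ 2 *
      (Real.exp (2 * K.lamA * K.σ) - 1) := by
  have hA := h.lamA_pos
  have hσ := hc.σ_pos
  have : 1 ≤ Real.exp (2 * K.lamA * K.σ) := Real.one_le_exp (by positivity)
  exact mul_nonneg (by positivity) (by linarith)

theorem α₀'_pos (h : Regular P K) (hc : UniformlyControllable P K) : 0 < K.α₀' := by
  have h1 := h.α₀'_inv_nonneg hc
  have h2 := hc.α₀_pos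
  unfold Constants.α₀'
  exact inv_pos.2 (add_pos_of_pos_of_nonneg (by positivity) h1)

theorem α₀'_le (h : Regular P K) (hc : UniformlyControllable P K) : K.α₀' ≤ K.α₀ := by
  have h1 := h.α₀'_inv_nonneg hc
  have h2 := hc.α₀_pos
  unfold Constants.α₀'
  refine inv_le_of_inv_le₀ h2 ?_
  have : K.α₀⁻¹ ≤ 2 / K.α₀ := by rw [← one_div]; gcongr; norm_num
  linarith

theorem c₁_pos (h : Regular P K) : 0 < K.c₁ := by
  have hg := h.growth_pos
  have := h.lamQ_pos
  have := h.gamR_pos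
  unfold Constants.c₁
  exact mul_pos (lt_max_of_lt_right (by positivity)) (Real.exp_pos _)

theorem lamQ_terminal_le_c₁ (h : Regular P K) :
    K.lamQ * (1 + 1 / (2 * K.growth)) * Real.exp (2 * K.growth * K.σ) ≤ K.c₁ := by
  have hg := h.growth_pos
  have := h.lamQ_pos
  have := h.lamQ_le
  unfold Constants.c₁
  gcongr
  refine le_trans ?_ (le_max_right _ _)
  gcongr

theorem interior_le_c₁ (h : Regular P K) (hc : UniformlyControllable P K) (hα : K.α₀ ≤ K.α₁') :
    K.lamQ * (1 + K.α₁' / K.α₀') ^ 2 * (1 / (2 * K.growth)) * Real.exp (2 * K.growth * K.σ) +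
      K.lamR * (1 / K.α₀') ≤ K.c₁ := by
  have hg := h.growth_pos
  have hQ := h.lamQ_pos
  have hR := h.lamR_pos
  have hB := h.lamB_pos
  have hα₀ := h.α₀'_pos hc
  have hα₁ := h.α₁'_pos hc.σ_pos
  set E := Real.exp (2 * K.growth * K.σ) with hE
  -- The steering cost `λ_R / α₀'` has one power of `α₀'` less than the term in `c₁`. The chain `α₀'
  -- ≤ α₀ ≤ α₁'` supplies the missing factor.
  have h1 : K.α₀' ≤ K.lamB ^ 2 * (1 / (2 * K.growth)) * E := by
    refine ((h.α₀'_le hc).trans hα).trans ?_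
    have : K.α₁' = K.lamB ^ 2 * (1 / (2 * K.growth)) * (E - 1) := by
      rw [hE, Constants.α₁', mul_right_comm 2 K.σ K.growth]
      ring
    rw [this]
    gcongr
    linarith
  have h2 : 1 / K.α₀' ≤ K.lamB ^ 2 / K.α₀' ^ 2 * (1 / (2 * K.growth)) * E := by
    rw [div_le_iff₀ hα₀]
    calc 1 = K.α₀' * (1 / K.α₀') := by field_simp
      _ ≤ K.lamB ^ 2 * (1 / (2 * K.growth)) * E * (1 / K.α₀') := by gcongr
      _ = _ := by field_simp
  have h3 : K.lamR * (1 / K.α₀') ≤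
      K.lamR * (K.lamB ^ 2 / K.α₀' ^ 2 * (1 / (2 * K.growth)) * E) := by gcongr
  have h4 : K.lamQ * (1 + K.α₁' / K.α₀') ^ 2 * (1 / (2 * K.growth)) * E ≤
      (K.lamQ + K.lamH ^ 2 / K.gamR) * (1 + K.α₁' / K.α₀') ^ 2 * (1 / (2 * K.growth)) * E := by
    gcongr
    exact h.lamQ_le
  calc _ ≤ (K.lamQ + K.lamH ^ 2 / K.gamR) * (1 + K.α₁' / K.α₀') ^ 2 * (1 / (2 * K.growth)) * E +
        K.lamR * (K.lamB ^ 2 / K.α₀' ^ 2 * (1 / (2 * K.growth)) * E) := add_le_add h4 h3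
    _ = ((K.lamQ + K.lamH ^ 2 / K.gamR) * (1 + K.α₁' / K.α₀') ^ 2
        + K.lamR * K.lamB ^ 2 / K.α₀' ^ 2) * (1 / (2 * K.growth)) * E := by ring
    _ ≤ _ := by
      unfold Constants.c₁
      gcongr
      exact le_max_left _ _

theorem norm_evolution_apply_le (h : Regular P K) {t s c : ℝ} (hts : t ≤ s) (hc : K.lamA ≤ c)
    (z : Vec nx) : ‖evolution P.A s t z‖ ≤ Real.exp (c * (s - t)) * ‖z‖ := by
  refine (evolution P.A s t).le_of_opNorm_le ((h.norm_evolution_le s t).trans ?_) z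
  rw [abs_of_nonneg (by linarith)]
  gcongr

end Regular

theorem hasDerivAt_exp_mul_sub (c t s : ℝ) :
    HasDerivAt (fun s => Real.exp (c * (s - t))) (c * Real.exp (c * (s - t))) s := by
  have := (((hasDerivAt_id s).sub_const t).const_mul c).exp
  simpa [mul_comm] using this

theorem exp_two_mul (c z : ℝ) : Real.exp (2 * c * z) = Real.exp (c * z) ^ 2 := by
  rw [sq, ← Real.exp_add]; ring_nf

/-- Within `σ` of the end the competitor is the uncontrolled trajectory, whose growth is at most
`e^{aσ}`. -/
theorem IsExtremal.inner_le_near_end (h : Regular P K) {a b : ℝ}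
    {x lam : ℝ → Vec nx} {u : ℝ → Vec nu} {G : Vec nx →L[ℝ] Vec nx}
    (hx : IsExtremal P a b x u lam) (hG : TerminalWeight K G) (hb : lam b = G (x b)) {t : ℝ}
    (ht : t ∈ Icc a b) (hσ : b - t ≤ K.σ) : inner ℝ (lam t) (x t) ≤ K.c₁ * ‖x t‖ ^ 2 := by
  have hg := h.growth_pos
  have hQ := h.lamQ_pos
  have hy := IsTrajectory.response h t b (x t) (u := fun _ => (0 : Vec nu)) continuous_const
  have hbound : ∀ s ∈ Icc t b,
      ‖response P t (x t) (fun _ => (0 : Vec nu)) s‖ ≤ Real.exp (K.growth * (s - t)) * ‖x t‖ := by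
    intro s hs
    simpa [response] using h.norm_evolution_apply_le hs.1 h.lamA_le_growth (x t)
  set y := response P t (x t) (fun _ => (0 : Vec nu))
  have hQy : ∀ s ∈ Icc t b, ∀ c, 0 ≤ c → c * ‖y s‖ ^ 2 ≤
      c * ‖x t‖ ^ 2 * Real.exp (2 * K.growth * (s - t)) := by
    intro s hs c hc
    have := hbound s hs
    calc c * ‖y s‖ ^ 2 ≤ c * (Real.exp (K.growth * (s - t)) * ‖x t‖) ^ 2 := by gcongr
      _ = _ := by rw [exp_two_mul]; ring
  have key := hx.inner_le_of_trajectory h ht.1 ht.2 le_rfl hy (response_self _ _ _)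
    (fun s _ => ((hasDerivAt_exp_mul_sub (2 * K.growth) t s).const_mul
      (K.lamQ * ‖x t‖ ^ 2 / (2 * K.growth))).hasDerivWithinAt) (fun s hs => by
      have h1 : stageCost P s (y s) 0 = inner ℝ (y s) (P.Q s (y s)) := by simp [stageCost]
      rw [h1]
      refine ((h.inner_Q_le s (y s)).trans (hQy s hs K.lamQ hQ.le)).trans_eq ?_
      field_simp)
  -- Positivity of the form of `G` at `y(b) - x(b)` replaces the end term by `⟨y(b), G y(b)⟩`.
  have hend : 2 * inner ℝ (lam b) (y b) - inner ℝ (lam b) (x b) ≤ K.lamQ * ‖y b‖ ^ 2 := by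
    have h1 := hG.upper (y b)
    have h2 := (mul_nonneg h.gamQ_pos.le (sq_nonneg _)).trans (hG.lower (y b - x b))
    simp only [map_sub, inner_sub_left, inner_sub_right, ← hG.symm (x b) (y b),
      real_inner_comm (G (x b)) (y b)] at h2
    rw [hb, hG.symm (x b) (x b)]
    linarith
  have h3 := hQy b (right_mem_Icc.2 ht.2) K.lamQ hQ.le
  have hexp : Real.exp (2 * K.growth * (b - t)) ≤ Real.exp (2 * K.growth * K.σ) := by gcongr
  have h4 : 0 ≤ K.lamQ * ‖x t‖ ^ 2 / (2 * K.growth) * Real.exp (2 * K.growth * (t - t)) := by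
    positivity
  calc inner ℝ (lam t) (x t)
      ≤ K.lamQ * ‖x t‖ ^ 2 * Real.exp (2 * K.growth * (b - t)) +
        K.lamQ * ‖x t‖ ^ 2 / (2 * K.growth) * Real.exp (2 * K.growth * (b - t)) := by linarith
    _ = K.lamQ * (1 + 1 / (2 * K.growth)) * Real.exp (2 * K.growth * (b - t)) * ‖x t‖ ^ 2 := by
        ring
    _ ≤ K.lamQ * (1 + 1 / (2 * K.growth)) * Real.exp (2 * K.growth * K.σ) * ‖x t‖ ^ 2 := by
        gcongr
    _ ≤ K.c₁ * ‖x t‖ ^ 2 := by gcongr; exact h.lamQ_terminal_le_c₁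

/-! ##### The controllability Gramian -/

namespace Regular

theorem continuous_evolution_comp (h : Regular P K) (t : ℝ) :
    Continuous fun s => evolution P.A t s ∘L P.B s :=
  (h.continuous_evolution_right t).clm_comp h.contB

theorem inner_gramian (h : Regular P K) (t s : ℝ) (x y : Vec nx) :
    inner ℝ y (gramian P.A P.B t s x) =
      ∫ r in t..s, inner ℝ ((evolution P.A t r ∘L P.B r).adjoint y)
        ((evolution P.A t r ∘L P.B r).adjoint x) := by
  have hc := h.continuous_evolution_comp t
  have := ContinuousLinearMap.intervalIntegral_comp_comm
    ((innerSL ℝ y).comp (ContinuousLinearMap.apply ℝ (Vec nx) x))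
    ((hc.clm_comp (continuous_adjoint_comp hc)).intervalIntegrable (μ := volume) t s)
  simp only [ContinuousLinearMap.comp_apply, ContinuousLinearMap.apply_apply,
    innerSL_apply_apply] at this
  rw [gramian, ← this]
  simp only [ContinuousLinearMap.adjoint_inner_left, ContinuousLinearMap.comp_apply]

theorem hasDerivAt_inner_gramian (h : Regular P K) (t s : ℝ) (x : Vec nx) :
    HasDerivAt (fun s => inner ℝ x (gramian P.A P.B t s x))
      (‖(evolution P.A t s ∘L P.B s).adjoint x‖ ^ 2) s := by
  simp only [h.inner_gramian, real_inner_self_eq_norm_sq]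
  have hc := continuous_adjoint_comp (h.continuous_evolution_comp t)
  exact (((hc.clm_apply continuous_const).norm.pow 2).integral_hasStrictDerivAt t s).hasDerivAt

theorem inner_gramian_symm (h : Regular P K) (t s : ℝ) (x y : Vec nx) :
    inner ℝ (gramian P.A P.B t s x) y = inner ℝ x (gramian P.A P.B t s y) := by
  rw [real_inner_comm, h.inner_gramian, h.inner_gramian]
  exact intervalIntegral.integral_congr fun r _ => real_inner_comm _ _

theorem gramian_self (t : ℝ) : gramian P.A P.B t t = 0 := intervalIntegral.integral_same

theorem inner_gramian_mono (h : Regular P K) {t s e : ℝ} (hse : s ≤ e) (x : Vec nx) :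
    inner ℝ x (gramian P.A P.B t s x) ≤ inner ℝ x (gramian P.A P.B t e x) := by
  have := sub_le_sub_of_hasDerivWithinAt_le hse
    (fun r _ => hasDerivWithinAt_const r (Icc s e) (0 : ℝ))
    (fun r _ => (h.hasDerivAt_inner_gramian t r x).hasDerivWithinAt)
    (fun r _ => sq_nonneg _)
  linarith

theorem inner_gramian_nonneg (h : Regular P K) {t s : ℝ} (hts : t ≤ s) (x : Vec nx) :
    0 ≤ inner ℝ x (gramian P.A P.B t s x) := by
  simpa [gramian_self] using h.inner_gramian_mono hts x (t := t)

theorem norm_adjoint_evolution_comp_le (h : Regular P K) {t s : ℝ} (hts : t ≤ s) (x : Vec nx) :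
    ‖(evolution P.A t s ∘L P.B s).adjoint x‖ ≤
      K.lamB * Real.exp (K.growth * (s - t)) * ‖x‖ := by
  refine ContinuousLinearMap.le_of_opNorm_le _ ?_ x
  rw [LinearIsometryEquiv.norm_map, mul_comm]
  refine (ContinuousLinearMap.opNorm_comp_le _ _).trans ?_
  gcongr
  · refine (h.norm_evolution_le t s).trans ?_
    rw [abs_sub_comm, abs_of_nonneg (by linarith)]
    have := h.lamA_le_growth
    gcongr
  · exact h.normB s

theorem inner_gramian_le (h : Regular P K) {t s : ℝ} (hts : t ≤ s) (hσ : s - t ≤ K.σ)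
    (x : Vec nx) : inner ℝ x (gramian P.A P.B t s x) ≤ K.α₁' * ‖x‖ ^ 2 := by
  have hg := h.growth_pos
  have hB := h.lamB_pos
  have key := sub_le_sub_of_hasDerivWithinAt_le hts
    (fun r _ => (h.hasDerivAt_inner_gramian t r x).hasDerivWithinAt)
    (fun r _ => ((hasDerivAt_exp_mul_sub (2 * K.growth) t r).const_mul
      (K.lamB ^ 2 * ‖x‖ ^ 2 / (2 * K.growth))).hasDerivWithinAt) (fun r hr => by
      have := h.norm_adjoint_evolution_comp_le hr.1 x
      calc ‖(evolution P.A t r ∘L P.B r).adjoint x‖ ^ 2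
          ≤ (K.lamB * Real.exp (K.growth * (r - t)) * ‖x‖) ^ 2 := by gcongr
        _ = _ := by rw [exp_two_mul]; field_simp)
  simp only [gramian_self, zero_apply, inner_zero_right, sub_self, mul_zero,
    Real.exp_zero, sub_zero, mul_one] at key
  have hexp : Real.exp (2 * K.growth * (s - t)) ≤ Real.exp (2 * K.σ * K.growth) := by
    rw [mul_right_comm 2 K.σ]; gcongr
  calc _ ≤ _ := key
    _ = K.lamB ^ 2 * ‖x‖ ^ 2 / (2 * K.growth) * (Real.exp (2 * K.growth * (s - t)) - 1) := by ring
    _ ≤ K.lamB ^ 2 * ‖x‖ ^ 2 / (2 * K.growth) * (Real.exp (2 * K.σ * K.growth) - 1) := by gcongr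
    _ = _ := by unfold Constants.α₁'; ring

/-- For `W(t,e) η = p` this control steers `p` to `0` at time `e`. -/
theorem response_gramian (h : Regular P K) (t s : ℝ) (p η : Vec nx) :
    response P t p (fun r => -(evolution P.A t r ∘L P.B r).adjoint η) s =
      evolution P.A s t (p - gramian P.A P.B t s η) := by
  have hc := h.continuous_evolution_comp t
  have := ContinuousLinearMap.intervalIntegral_comp_comm
    (ContinuousLinearMap.apply ℝ (Vec nx) η)
    ((hc.clm_comp (continuous_adjoint_comp hc)).intervalIntegrable (μ := volume) t s)
  simp only [ContinuousLinearMap.comp_apply, ContinuousLinearMap.apply_apply] at this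
  rw [response, gramian, ← this]
  simp only [map_neg, intervalIntegral.integral_neg, sub_eq_add_neg]

end Regular

/-- The competitor is driven to `0` at the controllability time `e` by the minimum-energy control,
with energy `⟨η, Wη⟩ = ⟨η, x(t)⟩`. Its end term vanishes and `-V(e) ≤ 0` is dropped. -/
theorem IsExtremal.inner_le_interior (h : Regular P K) (hc : UniformlyControllable P K) {a b : ℝ}
    (ha : 0 ≤ a) (hbT : b ≤ P.T) {x lam : ℝ → Vec nx} {u : ℝ → Vec nu}
    {G : Vec nx →L[ℝ] Vec nx} (hx : IsExtremal P a b x u lam) (hG : TerminalWeight K G)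
    (hb : lam b = G (x b)) {t : ℝ} (hat : a ≤ t) (htb : t + K.σ ≤ b) :
    inner ℝ (lam t) (x t) ≤ K.c₁ * ‖x t‖ ^ 2 := by
  -- A nonzero vector is needed to deduce `α₀ ≤ α₁'` from the two Gramian bounds.
  rcases eq_or_ne (x t) 0 with hp0 | hp0
  · simp [hp0]
  obtain ⟨e, ⟨hte, heσ⟩, hW₀, hW₁, -⟩ := hc.bounds t ⟨ha.trans hat, by linarith⟩
  have hg := h.growth_pos
  have hA := h.lamA_pos
  have hQ := h.lamQ_pos
  have hR := h.lamR_pos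
  have hα₀ := hc.α₀_pos
  have hα₁ := hc.α₁_pos
  have hσ := hc.σ_pos
  have hα₀' := h.α₀'_pos hc
  have hα₁' := h.α₁'_pos hσ
  have heb : e ≤ b := heσ.trans htb
  have hlow := (smul_one_le_iff_inner.1 hW₀).2
  obtain ⟨η, hη⟩ := exists_apply_eq_of_le_inner hα₀ hlow (x t)
  have hηn : ‖η‖ ≤ ‖x t‖ / K.α₀ := by
    simpa only [hη] using norm_le_of_le_inner hα₀ hlow η
  have hηi : inner ℝ η (x t) ≤ ‖x t‖ ^ 2 / K.α₀ := by
    calc inner ℝ η (x t) ≤ ‖η‖ * ‖x t‖ := real_inner_le_norm _ _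
      _ ≤ ‖x t‖ / K.α₀ * ‖x t‖ := by gcongr
      _ = _ := by ring
  have hαα : K.α₀ ≤ K.α₁' := by
    have h1 := (hlow (x t)).trans (h.inner_gramian_le hte (by linarith) (x t))
    exact le_of_mul_le_mul_right h1 (by have := norm_pos_iff.2 hp0; positivity)
  set v : ℝ → Vec nu := fun r => -(evolution P.A t r ∘L P.B r).adjoint η with hv
  have hvc : Continuous v :=
    ((continuous_adjoint_comp (h.continuous_evolution_comp t)).clm_apply continuous_const).neg
  have hy := IsTrajectory.response h t e (x t) hvc
  have hys : ∀ s, response P t (x t) v s = evolution P.A s t (x t - gramian P.A P.B t s η) :=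
    fun s => h.response_gramian t s (x t) η
  set y := response P t (x t) v
  have hye : y e = 0 := by rw [hys, hη, sub_self, map_zero]
  have hgram : ∀ s ∈ Icc t e, ∀ c, 0 < c →
      (∀ z, inner ℝ z (gramian P.A P.B t s z) ≤ c * ‖z‖ ^ 2) →
      ‖x t - gramian P.A P.B t s η‖ ≤ (1 + c / K.α₀) * ‖x t‖ := by
    intro s hs c hc0 hle
    have h1 := norm_apply_le_of_inner_le hc0 (h.inner_gramian_symm t s)
      (h.inner_gramian_nonneg hs.1) hle η
    calc _ ≤ ‖x t‖ + c * (‖x t‖ / K.α₀) := 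
          (norm_sub_le _ _).trans (by gcongr; exact h1.trans (by gcongr))
      _ = _ := by ring
  -- Two bounds of the same trajectory: this one, with `α₁` and `λ_A`, enters the cost of the
  -- shifted control and reproduces `α₀'`; `hy2`, with `α₁'` and `a`, enters the state cost as in
  -- `c₁`.
  have hy1 : ∀ s ∈ Icc t e, ‖y s‖ ^ 2 ≤
      (1 + K.α₁ / K.α₀) ^ 2 * ‖x t‖ ^ 2 * Real.exp (2 * K.lamA * (s - t)) := by
    intro s hs
    have h1 := hgram s hs K.α₁ hα₁ fun z =>
      (h.inner_gramian_mono hs.2 z).trans (inner_le_of_le_smul_one hW₁ z)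
    have h2 := h.norm_evolution_apply_le hs.1 le_rfl (x t - gramian P.A P.B t s η)
    rw [hys]
    calc _ ≤ (Real.exp (K.lamA * (s - t)) * ((1 + K.α₁ / K.α₀) * ‖x t‖)) ^ 2 := by
          gcongr; exact h2.trans (by gcongr)
      _ = _ := by rw [exp_two_mul]; ring
  have hy2 : ∀ s ∈ Icc t e, ‖y s‖ ^ 2 ≤
      (1 + K.α₁' / K.α₀') ^ 2 * ‖x t‖ ^ 2 * Real.exp (2 * K.growth * (s - t)) := by
    intro s hs
    have h1 := hgram s hs K.α₁' hα₁' fun z => h.inner_gramian_le hs.1 (by linarith [hs.2]) z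
    have h2 := h.norm_evolution_apply_le hs.1 h.lamA_le_growth (x t - gramian P.A P.B t s η)
    have h3 := h.α₀'_le hc
    rw [hys]
    calc _ ≤ (Real.exp (K.growth * (s - t)) * ((1 + K.α₁' / K.α₀') * ‖x t‖)) ^ 2 := by
          gcongr; exact h2.trans (by gcongr; exact h1.trans (by gcongr))
      _ = _ := by rw [exp_two_mul]; ring
  set κ := (1 + K.α₁ / K.α₀) ^ 2 * ‖x t‖ ^ 2 with hκ
  set κ' := (1 + K.α₁' / K.α₀') ^ 2 * ‖x t‖ ^ 2 with hκ'
  have key := hx.inner_le_of_trajectory h hat hte heb hy (response_self _ _ _)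
    (fun s _ => (((hasDerivAt_exp_mul_sub (2 * K.growth) t s).const_mul
      (K.lamQ * κ' / (2 * K.growth))).add
      (((h.hasDerivAt_inner_gramian t s η).const_mul 2).add
        ((hasDerivAt_exp_mul_sub (2 * K.lamA) t s).const_mul
          (2 * (K.lamH / K.gamR) ^ 2 * κ / (2 * K.lamA))) |>.const_mul K.lamR)).hasDerivWithinAt)
    (fun s hs => by
      have e1 := h.stageCost_le s (y s) (v s)
      have e2 := h.norm_shifted_sq_le s (y s) (v s)
      have e3 : ‖v s‖ ^ 2 = ‖(evolution P.A t s ∘L P.B s).adjoint η‖ ^ 2 := by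
        rw [hv, norm_neg]
      have e4 := mul_le_mul_of_nonneg_left (hy2 s hs) hQ.le
      have e5 := mul_le_mul_of_nonneg_left (hy1 s hs)
        (show 0 ≤ 2 * (K.lamH / K.gamR) ^ 2 by positivity)
      have e6 : ‖shifted P s (y s) (v s)‖ ^ 2 ≤
          2 * ‖(evolution P.A t s ∘L P.B s).adjoint η‖ ^ 2 +
          2 * (K.lamH / K.gamR) ^ 2 * (κ * Real.exp (2 * K.lamA * (s - t))) := by
        rw [← e3]; linarith
      have e7 := mul_le_mul_of_nonneg_left e6 hR.le
      have e8 : K.lamQ * κ' / (2 * K.growth) * (2 * K.growth * Real.exp (2 * K.growth * (s - t))) =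
          K.lamQ * (κ' * Real.exp (2 * K.growth * (s - t))) := by field_simp
      have e9 : 2 * (K.lamH / K.gamR) ^ 2 * κ / (2 * K.lamA) *
          (2 * K.lamA * Real.exp (2 * K.lamA * (s - t))) =
          2 * (K.lamH / K.gamR) ^ 2 * (κ * Real.exp (2 * K.lamA * (s - t))) := by
        generalize (K.lamH / K.gamR) ^ 2 = w
        field_simp
      rw [e8, e9]
      linarith)
  have hV := hx.inner_nonneg h hG hb (t := e) ⟨hat.trans hte, heb⟩
  simp only [Pi.add_apply, hye, inner_zero_right, hη, Regular.gramian_self,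
    zero_apply, sub_self, mul_zero, Real.exp_zero, mul_one, zero_add] at key
  have hexp1 : Real.exp (2 * K.growth * (e - t)) ≤ Real.exp (2 * K.growth * K.σ) := by
    gcongr; linarith
  have hexp2 : Real.exp (2 * K.lamA * (e - t)) ≤ Real.exp (2 * K.lamA * K.σ) := by
    gcongr; linarith
  -- The bound for the energy of the shifted control is exactly `‖x(t)‖² / α₀'`.
  have hinv : K.lamR * (2 * (‖x t‖ ^ 2 / K.α₀) + 2 * (K.lamH / K.gamR) ^ 2 * κ / (2 * K.lamA) *
      (Real.exp (2 * K.lamA * K.σ) - 1)) = K.lamR * (1 / K.α₀') * ‖x t‖ ^ 2 := by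
    rw [hκ, Constants.α₀', one_div, inv_inv]
    generalize (K.lamH / K.gamR) ^ 2 = w
    generalize (1 + K.α₁ / K.α₀) ^ 2 = w'
    field_simp
  have hκ0 : 0 ≤ κ := by positivity
  have hκ0' : 0 ≤ κ' := by positivity
  have b1 : K.lamQ * κ' / (2 * K.growth) * Real.exp (2 * K.growth * (e - t)) ≤
      K.lamQ * κ' / (2 * K.growth) * Real.exp (2 * K.growth * K.σ) := by gcongr
  have b2 : K.lamR * (2 * inner ℝ η (x t) + 2 * (K.lamH / K.gamR) ^ 2 * κ / (2 * K.lamA) *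
      (Real.exp (2 * K.lamA * (e - t)) - 1)) ≤
      K.lamR * (2 * (‖x t‖ ^ 2 / K.α₀) + 2 * (K.lamH / K.gamR) ^ 2 * κ / (2 * K.lamA) *
      (Real.exp (2 * K.lamA * K.σ) - 1)) := by gcongr
  have b3 : 0 ≤ K.lamQ * κ' / (2 * K.growth) := by positivity
  have hfin := mul_le_mul_of_nonneg_right (h.interior_le_c₁ hc hαα) (sq_nonneg ‖x t‖)
  calc inner ℝ (lam t) (x t)
      ≤ K.lamQ * κ' / (2 * K.growth) * Real.exp (2 * K.growth * K.σ) +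
        K.lamR * (1 / K.α₀') * ‖x t‖ ^ 2 := by rw [← hinv]; linarith
    _ = _ := by rw [hκ']; ring
    _ ≤ _ := hfin

theorem IsExtremal.inner_le_c₁_mul (h : Regular P K) (hc : UniformlyControllable P K) {a b : ℝ}
    (ha : 0 ≤ a) (hbT : b ≤ P.T) {x lam : ℝ → Vec nx} {u : ℝ → Vec nu}
    {G : Vec nx →L[ℝ] Vec nx} (hx : IsExtremal P a b x u lam) (hG : TerminalWeight K G)
    (hb : lam b = G (x b)) {t : ℝ} (ht : t ∈ Icc a b) :
    inner ℝ (lam t) (x t) ≤ K.c₁ * ‖x t‖ ^ 2 := by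
  rcases le_total (t + K.σ) b with hcase | hcase
  · exact hx.inner_le_interior h hc ha hbT hG hb ht.1 hcase
  · exact hx.inner_le_near_end h hG hb ht (by linarith)

end Schwarz

namespace Schwarz

variable {nx nu : ℕ} {P : Problem nx nu} {K : Constants}

/-! ### Exponential decay -/

theorem stagePolar_comm (h : Regular P K) (t : ℝ) (x y : Vec nx) (u v : Vec nu) :
    stagePolar P t x u y v = stagePolar P t y v x u := by
  unfold stagePolar
  simp only [inner_add_right, ContinuousLinearMap.adjoint_inner_right,
    real_inner_comm u (P.H t y), real_inner_comm v (P.H t x),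
    ← h.inner_Q_symm t x y, real_inner_comm y (P.Q t x), ← h.inner_R_symm t u v,
    real_inner_comm v (P.R t u)]
  ring

/-- The symplectic pairing of two extremals is constant. -/
theorem IsExtremal.inner_sub_inner_eq (h : Regular P K) {a b : ℝ} {x y lam mu : ℝ → Vec nx}
    {u v : ℝ → Vec nu} (hx : IsExtremal P a b x u lam) (hy : IsExtremal P a b y v mu) {t : ℝ}
    (ht : t ∈ Icc a b) :
    inner ℝ (lam t) (y t) - inner ℝ (mu t) (x t) =
      inner ℝ (lam b) (y b) - inner ℝ (mu b) (x b) := by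
  have hx' := hx.mono ht.1 le_rfl
  have hy' := hy.mono ht.1 le_rfl
  have hd : ∀ s ∈ Icc t b, HasDerivWithinAt
      (fun s => inner ℝ (lam s) (y s) - inner ℝ (mu s) (x s)) 0 (Icc t b) s := fun s hs => by
    refine ((hx'.hasDerivWithinAt_inner hy'.trajectory hs).sub
      (hy'.hasDerivWithinAt_inner hx'.trajectory hs)).congr_deriv ?_
    rw [stagePolar_comm h]
    ring
  have h0 : ∀ s ∈ Icc t b, HasDerivWithinAt (fun _ : ℝ => (0 : ℝ)) 0 (Icc t b) s :=
    fun s _ => hasDerivWithinAt_const s _ _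
  have h1 := sub_le_sub_of_hasDerivWithinAt_le ht.2 hd h0 fun _ _ => le_rfl
  have h2 := sub_le_sub_of_hasDerivWithinAt_le ht.2 h0 hd fun _ _ => le_rfl
  linarith

namespace Regular

theorem ρZ_pos (h : Regular P K) : 0 < K.ρZ := by
  have := h.gamQ_pos
  have := h.c₁_pos
  unfold Constants.ρZ
  positivity

theorem cZ_pos (h : Regular P K) (hσ : 0 < K.σ) : 0 < K.cZ :=
  Real.sqrt_pos.2 (div_pos h.c₁_pos (h.c₀_pos hσ))

end Regular

/-- Since `2ρ_Z c₁ = γ_Q`, the product `e^{2ρ_Z(r - s)} V(r)` is nonincreasing; the two-sided bound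
of `V` turns this into decay of `‖x‖`. -/
theorem IsExtremal.norm_le_exp_mul (h : Regular P K) (hc : UniformlyControllable P K) {a b : ℝ}
    (ha : 0 ≤ a) (hbT : b ≤ P.T) {x lam : ℝ → Vec nx} {u : ℝ → Vec nu}
    {G : Vec nx →L[ℝ] Vec nx} (hx : IsExtremal P a b x u lam) (hG : TerminalWeight K G)
    (hb : lam b = G (x b)) {s t : ℝ} (has : a ≤ s) (hst : s ≤ t) (htb : t ≤ b) :
    ‖x t‖ ≤ K.cZ * Real.exp (-K.ρZ * (t - s)) * ‖x s‖ := by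
  have hc₀ := h.c₀_pos hc.σ_pos
  have hc₁ := h.c₁_pos
  have hρ := h.ρZ_pos
  have hρc : 2 * K.ρZ * K.c₁ = K.gamQ := by unfold Constants.ρZ; field_simp
  have hx' := hx.mono has htb
  have hmem : ∀ r ∈ Icc s t, r ∈ Icc a b := fun r hr => ⟨has.trans hr.1, hr.2.trans htb⟩
  have key := sub_le_sub_of_hasDerivWithinAt_le hst
    (fun r hr => ((hasDerivAt_exp_mul_sub (2 * K.ρZ) s r).hasDerivWithinAt).mul
      (hx'.hasDerivWithinAt_inner_self hr))
    (fun r _ => hasDerivWithinAt_const r (Icc s t) (0 : ℝ)) (fun r hr => by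
      have h1 := hx.inner_le_c₁_mul h hc ha hbT hG hb (hmem r hr)
      have h2 := h.gamQ_le_stageCost r (x r) (u r)
      have h3 := mul_le_mul_of_nonneg_left h1 (show 0 ≤ 2 * K.ρZ by positivity)
      rw [← mul_assoc, hρc] at h3
      have h4 : 2 * K.ρZ * inner ℝ (lam r) (x r) - stageCost P r (x r) (u r) ≤ 0 := by linarith
      have h5 := mul_nonpos_of_nonneg_of_nonpos
        (Real.exp_pos (2 * K.ρZ * (r - s))).le h4
      linarith)
  simp only [Pi.mul_apply, sub_self, mul_zero, Real.exp_zero, one_mul] at key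
  have h1 := hx.c₀_mul_le_inner h hc.σ_pos hG hb (hmem t ⟨hst, le_rfl⟩)
  have h2 := hx.inner_le_c₁_mul h hc ha hbT hG hb (hmem s ⟨le_rfl, hst⟩)
  have hE := Real.exp_pos (2 * K.ρZ * (t - s))
  have h3 : Real.exp (2 * K.ρZ * (t - s)) * (K.c₀ * ‖x t‖ ^ 2) ≤ K.c₁ * ‖x s‖ ^ 2 := by
    have := mul_le_mul_of_nonneg_left h1 hE.le
    linarith
  have hsq : K.cZ ^ 2 = K.c₁ / K.c₀ := Real.sq_sqrt (div_pos hc₁ hc₀).le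
  refine le_of_sq_le_sq ?_ (by have := h.cZ_pos hc.σ_pos; positivity)
  rw [mul_pow, mul_pow, hsq, ← exp_two_mul]
  have h4 : Real.exp (2 * -K.ρZ * (t - s)) = (Real.exp (2 * K.ρZ * (t - s)))⁻¹ := by
    rw [← Real.exp_neg]; ring_nf
  rw [h4]
  calc ‖x t‖ ^ 2 = (Real.exp (2 * K.ρZ * (t - s)))⁻¹ *
        (Real.exp (2 * K.ρZ * (t - s)) * (K.c₀ * ‖x t‖ ^ 2)) / K.c₀ := by field_simp
    _ ≤ (Real.exp (2 * K.ρZ * (t - s)))⁻¹ * (K.c₁ * ‖x s‖ ^ 2) / K.c₀ := by gcongr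
    _ = _ := by ring

/-! ### Fundamental matrix of the Hamiltonian system -/

/-- The feedback map `(x, λ) ↦ R⁻¹(Hx + Bᵀλ)`. -/
def feedback (P : Problem nx nu) (t : ℝ) : Vec nx × Vec nx →L[ℝ] Vec nu :=
  (P.R t).inverse ∘L (P.H t ∘L ContinuousLinearMap.fst ℝ (Vec nx) (Vec nx) +
    (P.B t).adjoint ∘L ContinuousLinearMap.snd ℝ (Vec nx) (Vec nx))

/-- The coefficient of the Hamiltonian system for the pair `(x, λ)`. -/
def hamiltonian (P : Problem nx nu) (t : ℝ) : Vec nx × Vec nx →L[ℝ] Vec nx × Vec nx :=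
  ContinuousLinearMap.inl ℝ (Vec nx) (Vec nx) ∘L
    (P.A t ∘L ContinuousLinearMap.fst ℝ (Vec nx) (Vec nx) - P.B t ∘L feedback P t) +
  ContinuousLinearMap.inr ℝ (Vec nx) (Vec nx) ∘L
    ((P.H t).adjoint ∘L feedback P t - P.Q t ∘L ContinuousLinearMap.fst ℝ (Vec nx) (Vec nx) -
      (P.A t).adjoint ∘L ContinuousLinearMap.snd ℝ (Vec nx) (Vec nx))

theorem continuous_feedback (h : Regular P K) : Continuous (feedback P) :=
  h.continuous_R_inverse.clm_comp ((h.contH.clm_comp continuous_const).add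
    ((continuous_adjoint_comp h.contB).clm_comp continuous_const))

theorem continuous_hamiltonian (h : Regular P K) : Continuous (hamiltonian P) :=
  (continuous_const.clm_comp ((h.contA.clm_comp continuous_const).sub
    (h.contB.clm_comp (continuous_feedback h)))).add
  (continuous_const.clm_comp ((((continuous_adjoint_comp h.contH).clm_comp
    (continuous_feedback h)).sub (h.contQ.clm_comp continuous_const)).sub
    ((continuous_adjoint_comp h.contA).clm_comp continuous_const)))

/-- The matrix solution `(X, Λ)` of the Hamiltonian system on `[a, b]` with `X(b) = I`,
`Λ(b) = G`. -/
structure IsFundamentalPair (P : Problem nx nu) (a b : ℝ) (G : Vec nx →L[ℝ] Vec nx)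
    (X Λ : ℝ → Vec nx →L[ℝ] Vec nx) : Prop where
  X_end : X b = 1
  Λ_end : Λ b = G
  X_deriv : ∀ t ∈ Icc a b, HasDerivWithinAt X
    (P.A t ∘L X t - P.B t ∘L feedback P t ∘L (X t).prod (Λ t)) (Icc a b) t
  extremal : ∀ v, IsExtremal P a b (fun t => X t v) (fun t => -feedback P t (X t v, Λ t v))
    (fun t => Λ t v)

/-- The fundamental matrix of the Hamiltonian system based at `b`, applied to `v ↦ (v, Gv)`. The
coefficient is frozen outside `[a, b]` to be bounded on `ℝ`. -/
theorem exists_isFundamentalPair (h : Regular P K) {a b : ℝ} (hab : a ≤ b)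
    (G : Vec nx →L[ℝ] Vec nx) : ∃ X Λ, IsFundamentalPair P a b G X Λ := by
  set M : ℝ → (Vec nx × Vec nx →L[ℝ] Vec nx × Vec nx) :=
    fun t => hamiltonian P (projIcc a b hab t) with hM
  have hMc : Continuous M := (continuous_hamiltonian h).comp
    (continuous_subtype_val.comp continuous_projIcc)
  obtain ⟨C, hC⟩ := isCompact_Icc.exists_bound_of_continuousOn
    ((continuous_hamiltonian h).continuousOn (s := Icc a b))
  have hMb : ∀ t, ‖M t‖ ≤ C := fun t => hC _ (projIcc a b hab t).2
  have hMe : ∀ t ∈ Icc a b, M t = hamiltonian P t := fun t ht => by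
    simp [hM, projIcc_of_mem hab ht]
  set Ψ : ℝ → (Vec nx × Vec nx →L[ℝ] Vec nx × Vec nx) := fun t => LinearODE.fundamental M t b
    with hΨ
  have hΨd : ∀ t ∈ Icc a b, HasDerivWithinAt Ψ (hamiltonian P t ∘L Ψ t) (Icc a b) t :=
    fun t ht => by
      rw [← hMe t ht]
      exact (LinearODE.hasDerivAt_fundamental hMc hMb
        ContinuousLinearMap.norm_id_le t b).hasDerivWithinAt
  have hΨb : Ψ b = 1 := LinearODE.fundamental_self b
  set J : Vec nx →L[ℝ] Vec nx × Vec nx := (ContinuousLinearMap.id ℝ (Vec nx)).prod G with hJ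
  set X : ℝ → Vec nx →L[ℝ] Vec nx :=
    fun t => ContinuousLinearMap.fst ℝ (Vec nx) (Vec nx) ∘L Ψ t ∘L J with hX
  set Λ : ℝ → Vec nx →L[ℝ] Vec nx :=
    fun t => ContinuousLinearMap.snd ℝ (Vec nx) (Vec nx) ∘L Ψ t ∘L J with hΛ
  have hXd : ∀ t ∈ Icc a b, HasDerivWithinAt X
      (P.A t ∘L X t - P.B t ∘L feedback P t ∘L (X t).prod (Λ t)) (Icc a b) t := by
    intro t ht
    have h1 := (hasDerivWithinAt_const t (Icc a b)
      (ContinuousLinearMap.fst ℝ (Vec nx) (Vec nx))).clm_comp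
      ((hΨd t ht).clm_comp (hasDerivWithinAt_const t (Icc a b) J))
    refine h1.congr_deriv ?_
    ext1 v
    simp [hamiltonian, hX, hΛ]
  have hΛd : ∀ t ∈ Icc a b, HasDerivWithinAt Λ
      ((P.H t).adjoint ∘L feedback P t ∘L (X t).prod (Λ t) - P.Q t ∘L X t -
        (P.A t).adjoint ∘L Λ t) (Icc a b) t := by
    intro t ht
    have h1 := (hasDerivWithinAt_const t (Icc a b)
      (ContinuousLinearMap.snd ℝ (Vec nx) (Vec nx))).clm_comp
      ((hΨd t ht).clm_comp (hasDerivWithinAt_const t (Icc a b) J))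
    refine h1.congr_deriv ?_
    ext1 v
    simp [hamiltonian, hX, hΛ]
  refine ⟨X, Λ, ?_, ?_, hXd, fun v => ⟨⟨?_, fun t ht => ?_⟩, fun t ht => ?_, fun t ht => ?_⟩⟩
  · ext1 v; simp [hX, hΨb, hJ]
  · ext1 v; simp [hΛ, hΨb, hJ]
  · have hXc : ContinuousOn X (Icc a b) := fun t ht => (hXd t ht).continuousWithinAt
    have hΛc : ContinuousOn Λ (Icc a b) := fun t ht => (hΛd t ht).continuousWithinAt
    exact ((continuous_feedback h).continuousOn.clm_apply
      ((hXc.clm_apply continuousOn_const).prodMk (hΛc.clm_apply continuousOn_const))).neg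
  · refine ((hXd t ht).clm_apply (hasDerivWithinAt_const t (Icc a b) v)).congr_deriv ?_
    simp [sub_eq_add_neg]
  · refine ((hΛd t ht).clm_apply (hasDerivWithinAt_const t (Icc a b) v)).congr_deriv ?_
    simp only [sub_apply, ContinuousLinearMap.comp_apply, ContinuousLinearMap.prod_apply, map_neg,
      map_zero, add_zero]
    abel
  · have h1 : P.R t (feedback P t (X t v, Λ t v)) = P.H t (X t v) + (P.B t).adjoint (Λ t v) := by
      simp only [feedback, ContinuousLinearMap.comp_apply, h.R_inverse_apply]
      rfl
    simp only [map_neg, h1]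
    abel

namespace IsFundamentalPair

variable {a b : ℝ} {G : Vec nx →L[ℝ] Vec nx} {X Λ : ℝ → Vec nx →L[ℝ] Vec nx}

theorem terminal (hX : IsFundamentalPair P a b G X Λ) (v : Vec nx) : Λ b v = G (X b v) := by
  rw [hX.X_end, hX.Λ_end]; rfl

/-- If `X(t)v = 0`, then `V(t) = 0`, while `V(t) ≥ γ_Q ‖X(b)v‖² = γ_Q ‖v‖²`. -/
theorem isInvertible (hX : IsFundamentalPair P a b G X Λ) (h : Regular P K)
    (hG : TerminalWeight K G) {t : ℝ} (ht : t ∈ Icc a b) : (X t).IsInvertible := by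
  refine isInvertible_of_injective ((injective_iff_map_eq_zero (X t)).2 fun v hv => ?_)
  have h1 := (hX.extremal v).le_inner_terminal h hG (hX.terminal v) ht
  rw [hv, inner_zero_right, hX.X_end] at h1
  have h2 : ‖v‖ ^ 2 ≤ 0 := by
    by_contra hne
    have := mul_pos h.gamQ_pos (not_le.1 hne)
    exact absurd h1 (not_le.2 this)
  exact norm_eq_zero.1 (pow_eq_zero_iff two_ne_zero |>.1 (le_antisymm h2 (sq_nonneg _)))

theorem norm_X_inverse_le (hX : IsFundamentalPair P a b G X Λ) (h : Regular P K)
    (hc : UniformlyControllable P K) (ha : 0 ≤ a) (hbT : b ≤ P.T) (hG : TerminalWeight K G)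
    {s t : ℝ} (has : a ≤ s) (hst : s ≤ t) (htb : t ≤ b) (z : Vec nx) :
    ‖X t ((X s).inverse z)‖ ≤ K.cZ * Real.exp (-K.ρZ * (t - s)) * ‖z‖ := by
  have := (hX.extremal ((X s).inverse z)).norm_le_exp_mul h hc ha hbT hG (hX.terminal _) has hst htb
  rwa [(hX.isInvertible h hG ⟨has, hst.trans htb⟩).self_apply_inverse] at this

/-- The Riccati matrix `S = ΛX⁻¹` is symmetric. -/
theorem inner_riccati_symm (hX : IsFundamentalPair P a b G X Λ) (h : Regular P K)
    (hG : TerminalWeight K G) {t : ℝ} (ht : t ∈ Icc a b) (y z : Vec nx) :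
    inner ℝ (Λ t ((X t).inverse y)) z = inner ℝ y (Λ t ((X t).inverse z)) := by
  have hinv := (hX.isInvertible h hG ht).self_apply_inverse
  -- The pairing of two columns is constant, and at `b` it vanishes by symmetry of `G`.
  have h1 := (hX.extremal ((X t).inverse y)).inner_sub_inner_eq h
    (hX.extremal ((X t).inverse z)) ht
  simp only [hinv, hX.X_end, hX.Λ_end, one_apply_eq_self] at h1
  have h2 := hG.symm ((X t).inverse y) ((X t).inverse z)
  rw [real_inner_comm ((X t).inverse y)] at h1
  rw [real_inner_comm y] at h1
  linarith

theorem norm_riccati_le (hX : IsFundamentalPair P a b G X Λ) (h : Regular P K)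
    (hc : UniformlyControllable P K) (ha : 0 ≤ a) (hbT : b ≤ P.T)
    (hG : TerminalWeight K G) {t : ℝ} (ht : t ∈ Icc a b) (z : Vec nx) :
    ‖Λ t ((X t).inverse z)‖ ≤ K.c₁ * ‖z‖ := by
  have hinv := (hX.isInvertible h hG ht).self_apply_inverse
  refine norm_apply_le_of_inner_le h.c₁_pos (F := Λ t ∘L (X t).inverse)
    (hX.inner_riccati_symm h hG ht) (fun y => ?_) (fun y => ?_) z
  · have := (hX.extremal ((X t).inverse y)).inner_nonneg h hG (hX.terminal _) ht
    rwa [hinv, real_inner_comm] at this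
  · have := (hX.extremal ((X t).inverse y)).inner_le_c₁_mul h hc ha hbT hG (hX.terminal _) ht
    rwa [hinv, real_inner_comm] at this

/-- The defect `λ - Sx` of an extremal decays away from the right end. -/
theorem norm_defect_le (hX : IsFundamentalPair P a b G X Λ) (h : Regular P K)
    (hc : UniformlyControllable P K) (ha : 0 ≤ a) (hbT : b ≤ P.T) (hG : TerminalWeight K G)
    {x lam : ℝ → Vec nx} {u : ℝ → Vec nu} (hx : IsExtremal P a b x u lam) {t : ℝ}
    (ht : t ∈ Icc a b) :
    ‖lam t - Λ t ((X t).inverse (x t))‖ ≤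
      K.cZ * Real.exp (-K.ρZ * (b - t)) * ‖lam b - G (x b)‖ := by
  have hinv := (hX.isInvertible h hG ht).self_apply_inverse
  have hcZ := h.cZ_pos hc.σ_pos
  set r := lam t - Λ t ((X t).inverse (x t)) with hr
  -- The pairing with the column through state `r` at time `t` equals `‖r‖²` at `t` and `⟨λ(b) -
  -- Gx(b), X(t)⁻¹r⟩` at `b`, where `X(t)⁻¹r` is exponentially small.
  have h1 := hx.inner_sub_inner_eq h (hX.extremal ((X t).inverse r)) ht
  simp only [hinv, hX.X_end, hX.Λ_end, one_apply_eq_self] at h1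
  have h2 : inner ℝ (lam t) r - inner ℝ (Λ t ((X t).inverse r)) (x t) = ‖r‖ ^ 2 := by
    rw [hX.inner_riccati_symm h hG ht, real_inner_comm (Λ t ((X t).inverse (x t))) r,
      ← inner_sub_left, ← hr, real_inner_self_eq_norm_sq]
  have h3 : inner ℝ (lam b) ((X t).inverse r) - inner ℝ (G ((X t).inverse r)) (x b) =
      inner ℝ (lam b - G (x b)) ((X t).inverse r) := by
    rw [inner_sub_left, hG.symm, real_inner_comm (G (x b))]
  have h4 := hX.norm_X_inverse_le h hc ha hbT hG ht.1 ht.2 le_rfl r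
  rw [hX.X_end, one_apply_eq_self] at h4
  have h5 : ‖r‖ * ‖r‖ ≤
      ‖r‖ * (K.cZ * Real.exp (-K.ρZ * (b - t)) * ‖lam b - G (x b)‖) := by
    calc ‖r‖ * ‖r‖ = inner ℝ (lam b - G (x b)) ((X t).inverse r) := by
          rw [← h3, ← h1, h2, sq]
      _ ≤ ‖lam b - G (x b)‖ * ‖(X t).inverse r‖ := real_inner_le_norm _ _
      _ ≤ ‖lam b - G (x b)‖ * (K.cZ * Real.exp (-K.ρZ * (b - t)) * ‖r‖) := by gcongr
      _ = _ := by ring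
  rcases eq_or_lt_of_le (norm_nonneg r) with h0 | h0
  · rw [← h0]; positivity
  · exact le_of_mul_le_mul_left h5 h0

/-- Variation of constants for `ẋ = (closed loop) x - BR⁻¹Bᵀr` with `r = λ - Sx`. -/
theorem hasDerivWithinAt_X_inverse_apply (hX : IsFundamentalPair P a b G X Λ) (h : Regular P K)
    (hab : a < b) (hG : TerminalWeight K G) {x lam : ℝ → Vec nx} {u : ℝ → Vec nu}
    (hx : IsExtremal P a b x u lam) {t : ℝ} (ht : t ∈ Icc a b) :
    HasDerivWithinAt (fun t => (X t).inverse (x t))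
      (-(X t).inverse (P.B t ((P.R t).inverse
        ((P.B t).adjoint (lam t - Λ t ((X t).inverse (x t))))))) (Icc a b) t := by
  have hi := hX.isInvertible h hG ht
  have hd : HasDerivWithinAt (fun t => (X t).inverse) _ (Icc a b) t :=
    ((hi.contDiffAt_map_inverse (n := 1)).differentiableAt one_ne_zero).hasFDerivAt
      |>.comp_hasDerivWithinAt t (hX.X_deriv t ht)
  have hy := hd.clm_apply (hx.trajectory.state t ht)
  refine hy.congr_deriv ?_
  set y' := _ + (X t).inverse (P.A t (x t) + P.B t (u t))
  -- Only differentiability of `X⁻¹` is used. The derivative `y'` of `z = X⁻¹x` is identified by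
  -- differentiating `x = Xz` and using uniqueness of derivatives on a nondegenerate interval.
  have hprod := (hX.X_deriv t ht).clm_apply hy
  have hXy : ∀ s ∈ Icc a b, x s = X s ((X s).inverse (x s)) := fun s hs =>
    ((hX.isInvertible h hG hs).self_apply_inverse _).symm
  have huniq := (uniqueDiffOn_Icc hab t ht).eq_deriv _ (hx.trajectory.state t ht)
    (hprod.congr hXy (hXy t ht))
  have hu := hx.control_eq h ht
  have hX' : (P.A t ∘L X t - P.B t ∘L feedback P t ∘L (X t).prod (Λ t)) ((X t).inverse (x t)) =
      P.A t (x t) - P.B t ((P.R t).inverse (P.H t (x t) +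
        (P.B t).adjoint (Λ t ((X t).inverse (x t))))) := by
    simp [feedback, hi.self_apply_inverse]
  rw [hX', hu] at huniq
  have h1 : X t y' = -(P.B t ((P.R t).inverse
      ((P.B t).adjoint (lam t - Λ t ((X t).inverse (x t)))))) := by
    rw [← sub_eq_iff_eq_add'] at huniq
    rw [← huniq]
    simp only [map_add, map_sub, map_neg]
    abel
  rw [← map_neg, ← h1, hi.inverse_apply_self]

theorem norm_state_le (hX : IsFundamentalPair P a b G X Λ) (h : Regular P K)
    (hc : UniformlyControllable P K) (ha : 0 ≤ a) (hab : a < b) (hbT : b ≤ P.T)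
    (hG : TerminalWeight K G) {x lam : ℝ → Vec nx} {u : ℝ → Vec nu}
    (hx : IsExtremal P a b x u lam) {t : ℝ} (ht : t ∈ Icc a b) :
    ‖x t‖ ≤ K.cZ * Real.exp (-K.ρZ * (t - a)) * ‖x a‖ +
      K.cZ ^ 2 * K.lamB ^ 2 / (2 * K.ρZ * K.gamR) * Real.exp (-K.ρZ * (b - t)) *
        ‖lam b - G (x b)‖ := by
  have hcZ := h.cZ_pos hc.σ_pos
  have hρ := h.ρZ_pos
  have hr := h.gamR_pos
  have hB := h.lamB_pos
  set g := ‖lam b - G (x b)‖ with hg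
  have hg0 : 0 ≤ g := norm_nonneg _
  set C := K.cZ ^ 2 * K.lamB ^ 2 / K.gamR * g with hC
  have hC0 : 0 ≤ C := by positivity
  have hsub : Icc a t ⊆ Icc a b := Icc_subset_Icc_right ht.2
  have hder : ∀ s ∈ Icc a b, HasDerivWithinAt (fun s => X t ((X s).inverse (x s)))
      (X t (-(X s).inverse (P.B s ((P.R s).inverse
        ((P.B s).adjoint (lam s - Λ s ((X s).inverse (x s)))))))) (Icc a b) s := fun s hs =>
    (X t).hasFDerivAt.comp_hasDerivWithinAt s (hX.hasDerivWithinAt_X_inverse_apply h hab hG hx hs)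
  -- The curve `s ↦ X(t)X(s)⁻¹x(s)` joins the propagated initial state at `s = a` to `x(t)` at `s =
  -- t`. Its speed is at most `C e^{-ρ(t-s)} e^{-ρ(b-s)} = C e^{2ρ(s-(t+b)/2)}`, the derivative of
  -- the chosen majorant.
  have key := image_norm_le_of_norm_deriv_right_le_deriv_boundary' (a := a) (b := t)
    (f := fun s => X t ((X s).inverse (x s)))
    (B := fun s => K.cZ * Real.exp (-K.ρZ * (t - a)) * ‖x a‖ +
      C / (2 * K.ρZ) * (Real.exp (2 * K.ρZ * (s - (t + b) / 2)) -
        Real.exp (2 * K.ρZ * (a - (t + b) / 2))))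
    (B' := fun s => C / (2 * K.ρZ) * (2 * K.ρZ * Real.exp (2 * K.ρZ * (s - (t + b) / 2))))
    (fun s hs => ((hder s (hsub hs)).mono hsub).continuousWithinAt)
    (fun s hs => (hder s (hsub ⟨hs.1, hs.2.le⟩)).mono_of_mem_nhdsWithin
      (Icc_mem_nhdsGE_of_mem ⟨hs.1, hs.2.trans_le ht.2⟩))
    (by simpa using hX.norm_X_inverse_le h hc ha hbT hG le_rfl ht.1 ht.2 (x a))
    (Continuous.continuousOn (by fun_prop))
    (fun s _ => ((((hasDerivAt_exp_mul_sub (2 * K.ρZ) ((t + b) / 2) s).sub_const _).const_mul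
      _).const_add _).hasDerivWithinAt)
    (fun s hs => by
      have hs' : s ∈ Icc a b := hsub ⟨hs.1, hs.2.le⟩
      set r := lam s - Λ s ((X s).inverse (x s)) with hrdef
      have e1 := hX.norm_defect_le h hc ha hbT hG hx hs'
      have e2 : ‖P.B s ((P.R s).inverse ((P.B s).adjoint r))‖ ≤
          K.lamB * (K.lamB * ‖r‖ / K.gamR) := by
        refine (P.B s).le_of_opNorm_le_of_le (h.normB s) ?_
        refine (h.norm_R_inverse_apply_le s _).trans ?_
        gcongr
        refine ContinuousLinearMap.le_of_opNorm_le _ ?_ r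
        rw [LinearIsometryEquiv.norm_map]
        exact h.normB s
      have e3 := hX.norm_X_inverse_le h hc ha hbT hG hs.1 hs.2.le ht.2
        (P.B s ((P.R s).inverse ((P.B s).adjoint r)))
      have e4 : Real.exp (-K.ρZ * (t - s)) * Real.exp (-K.ρZ * (b - s)) =
          Real.exp (2 * K.ρZ * (s - (t + b) / 2)) := by
        rw [← Real.exp_add]; ring_nf
      rw [map_neg, norm_neg]
      calc _ ≤ _ := e3
        _ ≤ K.cZ * Real.exp (-K.ρZ * (t - s)) * (K.lamB * (K.lamB *
            (K.cZ * Real.exp (-K.ρZ * (b - s)) * g) / K.gamR)) := by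
          gcongr
          exact e2.trans (by gcongr)
        _ = C * (Real.exp (-K.ρZ * (t - s)) * Real.exp (-K.ρZ * (b - s))) := by rw [hC]; ring
        _ = C / (2 * K.ρZ) * (2 * K.ρZ * Real.exp (2 * K.ρZ * (s - (t + b) / 2))) := by
          rw [e4]; field_simp)
    (right_mem_Icc.2 ht.1)
  simp only [(hX.isInvertible h hG ht).self_apply_inverse] at key
  have e5 : Real.exp (2 * K.ρZ * (t - (t + b) / 2)) = Real.exp (-K.ρZ * (b - t)) := by ring_nf
  rw [e5] at key
  have e6 : 0 ≤ C / (2 * K.ρZ) * Real.exp (2 * K.ρZ * (a - (t + b) / 2)) := by positivity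
  have e7 : K.cZ ^ 2 * K.lamB ^ 2 / (2 * K.ρZ * K.gamR) * Real.exp (-K.ρZ * (b - t)) * g =
      C / (2 * K.ρZ) * Real.exp (-K.ρZ * (b - t)) := by rw [hC]; field_simp
  rw [e7]
  linarith

end IsFundamentalPair

/-- Decay of the influence of the boundary data on an extremal. -/
theorem IsExtremal.norm_le_boundary (h : Regular P K) (hc : UniformlyControllable P K) {a b : ℝ}
    (ha : 0 ≤ a) (hab : a < b) (hbT : b ≤ P.T) {x lam : ℝ → Vec nx} {u : ℝ → Vec nu}
    {G : Vec nx →L[ℝ] Vec nx} (hG : TerminalWeight K G) (hx : IsExtremal P a b x u lam) {δ : ℝ}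
    (hδ : ‖lam b - G (x b)‖ ≤ K.lamQ * δ) {t : ℝ} (ht : t ∈ Icc a b) :
    ‖x t‖ + ‖u t‖ + ‖lam t‖ ≤ K.Λb K.lamQ *
      (Real.exp (-K.ρZ * (t - a)) * ‖x a‖ + Real.exp (-K.ρZ * (b - t)) * δ) := by
  obtain ⟨X, Λ, hX⟩ := exists_isFundamentalPair h hab.le G
  have hcZ := h.cZ_pos hc.σ_pos
  have hρ := h.ρZ_pos
  have hr := h.gamR_pos
  have hB := h.lamB_pos
  have hH := h.lamH_pos
  have hQ := h.lamQ_pos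
  have hc₁ := h.c₁_pos
  have hδ0 : 0 ≤ δ := nonneg_of_mul_nonneg_right ((norm_nonneg _).trans hδ) hQ
  have h1 := hX.norm_state_le h hc ha hab hbT hG hx ht
  have h2 := hX.norm_defect_le h hc ha hbT hG hx ht
  have h3 := hX.norm_riccati_le h hc ha hbT hG ht (x t)
  set r := lam t - Λ t ((X t).inverse (x t)) with hrdef
  have hlam : ‖lam t‖ ≤ K.c₁ * ‖x t‖ + ‖r‖ := by
    have : lam t = Λ t ((X t).inverse (x t)) + r := by rw [hrdef]; abel
    rw [this]
    exact (norm_add_le _ _).trans (by gcongr)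
  have hu : ‖u t‖ ≤ K.lamH / K.gamR * ‖x t‖ + K.lamB / K.gamR * ‖lam t‖ := by
    rw [hx.control_eq h ht, norm_neg]
    refine (h.norm_R_inverse_apply_le t _).trans ?_
    rw [div_mul_eq_mul_div, div_mul_eq_mul_div, ← add_div]
    gcongr
    refine (norm_add_le _ _).trans (add_le_add ((P.H t).le_of_opNorm_le (h.normH t) _) ?_)
    refine ContinuousLinearMap.le_of_opNorm_le _ ?_ _
    rw [LinearIsometryEquiv.norm_map]
    exact h.normB t
  set E₀ := Real.exp (-K.ρZ * (t - a)) * ‖x a‖ with hE₀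
  set E₁ := Real.exp (-K.ρZ * (b - t)) * δ with hE₁
  have hE₀0 : 0 ≤ E₀ := by positivity
  have hE₁0 : 0 ≤ E₁ := by positivity
  -- One constant for both end contributions to `x`; it also dominates the factor `c_Z` of the
  -- defect.
  set m := max K.cZ (K.cZ ^ 2 * K.lamB ^ 2 * K.lamQ / (2 * K.ρZ * K.gamR)) with hm
  have hm1 : K.cZ ≤ m := le_max_left _ _
  have hm2 : K.cZ ^ 2 * K.lamB ^ 2 * K.lamQ / (2 * K.ρZ * K.gamR) ≤ m := le_max_right _ _
  have hx1 : ‖x t‖ ≤ m * (E₀ + E₁) := by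
    calc ‖x t‖ ≤ _ := h1
      _ ≤ K.cZ * Real.exp (-K.ρZ * (t - a)) * ‖x a‖ +
        K.cZ ^ 2 * K.lamB ^ 2 / (2 * K.ρZ * K.gamR) * Real.exp (-K.ρZ * (b - t)) *
          (K.lamQ * δ) := by gcongr
      _ = K.cZ * E₀ + K.cZ ^ 2 * K.lamB ^ 2 * K.lamQ / (2 * K.ρZ * K.gamR) * E₁ := by
        rw [hE₀, hE₁]; ring
      _ ≤ m * E₀ + m * E₁ := by gcongr
      _ = _ := by ring
  have hr1 : ‖r‖ ≤ K.lamQ * (m * (E₀ + E₁)) := by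
    calc ‖r‖ ≤ _ := h2
      _ ≤ K.cZ * Real.exp (-K.ρZ * (b - t)) * (K.lamQ * δ) := by gcongr
      _ = K.lamQ * (K.cZ * E₁) := by rw [hE₁]; ring
      _ ≤ K.lamQ * (m * (E₀ + E₁)) := by gcongr; linarith
  calc ‖x t‖ + ‖u t‖ + ‖lam t‖
      ≤ ‖x t‖ + (K.lamH / K.gamR * ‖x t‖ + K.lamB / K.gamR * ‖lam t‖) + ‖lam t‖ := by gcongr
    _ = (1 + K.lamH / K.gamR) * ‖x t‖ + (1 + K.lamB / K.gamR) * ‖lam t‖ := by ring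
    _ ≤ (1 + K.lamH / K.gamR) * (m * (E₀ + E₁)) +
        (1 + K.lamB / K.gamR) * (K.c₁ * (m * (E₀ + E₁)) + K.lamQ * (m * (E₀ + E₁))) := by
      gcongr
      exact hlam.trans (by gcongr)
    _ = K.Λb K.lamQ * (E₀ + E₁) := by rw [Constants.Λb, ← hm]; ring

end Schwarz

namespace Schwarz

variable {nx nu m : ℕ} {P : Problem nx nu} {K : Constants}

/-! ### The Schwarz iteration -/

theorem hasGradientAt_quadratic {n : ℕ} {F : Vec n →L[ℝ] Vec n}
    (hF : ∀ x y, inner ℝ (F x) y = inner ℝ x (F y)) (w z : Vec n) :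
    HasGradientAt (fun z => (1 / 2) * inner ℝ z (F z) - inner ℝ z w) (F z - w) z := by
  rw [hasGradientAt_iff_hasFDerivAt]
  have h1 := ((hasFDerivAt_id z).inner ℝ F.hasFDerivAt).const_mul (1 / 2 : ℝ)
  have h2 := (hasFDerivAt_id z).inner ℝ (hasFDerivAt_const w z)
  refine (h1.sub h2).congr_fderiv ?_
  ext y
  simp only [id, InnerProductSpace.toDual_apply_apply, sub_apply, smul_apply,
    ContinuousLinearMap.comp_apply, ContinuousLinearMap.prod_apply, fderivInnerCLM_apply,
    ContinuousLinearMap.id_apply, zero_apply, inner_zero_right, inner_sub_left, smul_eq_mul,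
    ← hF z y, real_inner_comm (F z) y, real_inner_comm w y]
  ring

theorem hasGradientAt_fullTerminalCost
    (hF : ∀ x y, inner ℝ (P.QT x) y = inner ℝ x (P.QT y)) (z : Vec nx) :
    HasGradientAt (fullTerminalCost P) (P.QT z) z := by
  have := hasGradientAt_quadratic hF 0 z
  simp only [inner_zero_right, sub_zero] at this
  exact this

/-! ### Position of the cells within the overlapping intervals. -/

namespace Decomposition

variable {T : ℝ} (D : Decomposition T m) (j : Fin m)

theorem t_nonneg (i : Fin (m + 1)) : 0 ≤ D.t i := 
  D.t_zero.symm.trans_le (D.strictMono.monotone (Fin.zero_le i))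

theorem t_le (i : Fin (m + 1)) : D.t i ≤ T := 
  (D.strictMono.monotone (Fin.le_last i)).trans_eq D.t_last

theorem left_nonneg : 0 ≤ D.left j := le_max_right _ _

theorem left_le : D.left j ≤ D.t j.castSucc :=
  max_le (by linarith [D.τ₀_pos j]) (D.t_nonneg _)

theorem le_right : D.t j.succ ≤ D.right j :=
  le_min (by linarith [D.τ₁_pos j]) (D.t_le _)

theorem right_le : D.right j ≤ T := min_le_right _ _

theorem t_lt : D.t j.castSucc < D.t j.succ := D.strictMono j.castSucc_lt_succ

theorem left_lt_right : D.left j < D.right j :=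
  (D.left_le j).trans_lt ((D.t_lt j).trans_le (D.le_right j))

theorem right_last (hj : j.succ = Fin.last m) : D.right j = T := by
  rw [right, hj, D.t_last]
  exact min_eq_right (by linarith [D.τ₁_pos j])

theorem τ_le : D.τ ≤ min (D.τ₀ j) (D.τ₁ j) := ciInf_le (Set.finite_range _).bddBelow j

theorem cell_subset : D.cell j ⊆ Icc (D.t j.castSucc) (D.t j.succ) := by
  unfold cell
  split_ifs
  exacts [subset_rfl, Ico_subset_Icc_self]

theorem left_mem_cell : D.t j.castSucc ∈ D.cell j := by
  unfold cell
  split_ifs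
  exacts [⟨le_rfl, (D.t_lt j).le⟩, ⟨le_rfl, D.t_lt j⟩]

end Decomposition

/-- The first subproblem starts at time `0` from the previous iterate's value there, and its cell
contains `0`, so the exact initial state is passed on. -/
theorem IsSchwarzRun.initial {D : Decomposition P.T m} {x : ℕ → ℝ → Vec nx}
    {u : ℕ → ℝ → Vec nu} {lam : ℕ → ℝ → Vec nx} {xs : ℕ → Fin m → ℝ → Vec nx}
    {us : ℕ → Fin m → ℝ → Vec nu} {lams : ℕ → Fin m → ℝ → Vec nx}
    (hrun : IsSchwarzRun P D x u lam xs us lams) (hm : 0 < m) (k : ℕ) : x k 0 = P.x₀ := by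
  induction k with
  | zero => exact hrun.init
  | succ k ih =>
    set j : Fin m := ⟨0, hm⟩
    have ht : D.t j.castSucc = 0 := D.t_zero
    have hleft : D.left j = 0 := le_antisymm (ht ▸ D.left_le j) (D.left_nonneg j)
    have h1 := (hrun.aggregate k j 0 (ht ▸ D.left_mem_cell j)).1
    have h2 := (hrun.solve k j).admissible.initial (D.left_lt_right j).le
    rw [hleft, ih] at h2
    rw [h1, h2]

theorem Regular.Λb_nonneg (h : Regular P K) (hσ : 0 < K.σ) : 0 ≤ K.Λb K.lamQ := by
  have := h.lamH_pos
  have := h.gamR_pos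
  have := h.lamB_pos
  have := h.c₁_pos
  have := h.lamQ_pos
  have := h.cZ_pos hσ
  unfold Constants.Λb
  exact mul_nonneg (by positivity) (le_max_of_le_left (by positivity))

/-- Error of a subproblem solution in terms of the boundary data. -/
theorem IsSubSolution.error_le (hbdd : BoundedMatrices P K) (hucc : UniformlyControllable P K)
    (hcoer : Coercive P K) {D : Decomposition P.T m} {xStar : ℝ → Vec nx} {uStar : ℝ → Vec nu}
    {lamStar : ℝ → Vec nx} (hstar : IsFullSolution P xStar uStar lamStar) {j : Fin m}
    {x lam y mu : ℝ → Vec nx} {v : ℝ → Vec nu} (hx0 : x 0 = P.x₀)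
    (hsub : IsSubSolution P D j (x (D.left j))
      (x (D.right j) - (P.Q (D.right j)).inverse (lam (D.right j))) y v mu)
    (hτ : j.succ ≠ Fin.last m → D.t j.succ + D.τ ≤ P.T) {t : ℝ}
    (ht : t ∈ Icc (D.t j.castSucc) (D.t j.succ)) :
    ‖y t - xStar t‖ + ‖v t - uStar t‖ + ‖mu t - lamStar t‖ ≤
      K.c * Real.exp (-K.ρZ * D.τ) * boundaryError D j x lam xStar lamStar := by
  have hT : 0 < P.T := hucc.σ_pos.trans hucc.σ_lt
  have h := Problem.regular_extend hbdd hcoer hT.le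
  have hc := hucc.extend hT.le
  have hγ := hcoer.gamQ_pos
  have hρ := h.ρZ_pos
  have hlr := D.left_lt_right j
  have hl0 := D.left_nonneg j
  have hrT := D.right_le j
  have hstar0 : xStar 0 = P.x₀ := hstar.admissible.initial hT.le
  have hya : y (D.left j) = x (D.left j) := hsub.admissible.initial hlr.le
  have hstar' : IsExtremal (P.extend hT.le) 0 P.T xStar uStar lamStar :=
    (hstar.extend le_rfl hT.le le_rfl).isExtremal h hT
  have hsub' : IsExtremal (P.extend hT.le) (D.left j) (D.right j) y v mu :=
    (hsub.extend hl0 hlr.le hrT).isExtremal h hlr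
  have hdiff := hsub'.sub (hstar'.mono hl0 hrT)
  have htmem : t ∈ Icc (D.left j) (D.right j) :=
    ⟨(D.left_le j).trans ht.1, ht.2.trans (D.le_right j)⟩
  have hΛ := h.Λb_nonneg hucc.σ_pos
  have hleft : Real.exp (-K.ρZ * (t - D.left j)) * ‖y (D.left j) - xStar (D.left j)‖ ≤
      Real.exp (-K.ρZ * D.τ) * ‖x (D.left j) - xStar (D.left j)‖ := by
    rw [hya]
    -- If the overlap is cut off at `0` the decay may be lost, but then the initial error is zero;
    -- otherwise the distance is at least `τ`.
    rcases le_total (D.t j.castSucc - D.τ₀ j) 0 with hcase | hcase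
    · have : D.left j = 0 := max_eq_right hcase
      rw [this, hx0, hstar0]
      simp
    · have h1 : D.left j = D.t j.castSucc - D.τ₀ j := max_eq_left hcase
      have h2 := (D.τ_le j).trans (min_le_left _ _)
      have h3 : K.ρZ * D.τ ≤ K.ρZ * (t - D.left j) := by gcongr; linarith [ht.1]
      gcongr Real.exp ?_ * _
      linarith
  set e₀ := ‖x (D.left j) - xStar (D.left j)‖ with he₀
  have he₀0 : 0 ≤ e₀ := norm_nonneg _
  have hE := Real.exp_pos (-K.ρZ * D.τ)
  have hone : 0 ≤ 1 / K.gamQ := by positivity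
  by_cases hj : j.succ = Fin.last m
  · have hQT := smul_one_le_iff_inner.1 hcoer.lowerQT
    have hG : TerminalWeight K P.QT :=
      ⟨hQT.1, hQT.2, inner_le_of_le_smul_one hcoer.upperQT⟩
    have hcost : subTerminalCost P D j
        (x (D.right j) - (P.Q (D.right j)).inverse (lam (D.right j))) = fullTerminalCost P := by
      funext z; simp [subTerminalCost, fullTerminalCost, hj]
    have hright := D.right_last j hj
    have g1 : mu (D.right j) = P.QT (y (D.right j)) := by
      have := hsub.adjoint_end
      rw [hcost] at this
      exact this.unique (hasGradientAt_fullTerminalCost hQT.1 _)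
    have g2 : lamStar (D.right j) = P.QT (xStar (D.right j)) := by
      rw [hright]
      exact hstar.adjoint_end.unique (hasGradientAt_fullTerminalCost hQT.1 _)
    have key := hdiff.norm_le_boundary h hc hl0 hlr hrT hG (δ := 0)
      (by simp [g1, g2]) htmem
    have hbe : boundaryError D j x lam xStar lamStar = e₀ := by simp [boundaryError, hj, he₀]
    rw [hbe]
    calc _ ≤ _ := key
      _ ≤ K.Λb K.lamQ * (Real.exp (-K.ρZ * D.τ) * e₀) := by
        rw [mul_zero, add_zero]; gcongr
      -- On the last subdomain the defect is zero; the extra factor only unifies the constant.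
      _ ≤ K.Λb K.lamQ * (Real.exp (-K.ρZ * D.τ) * e₀) * (1 + 1 / K.gamQ) :=
        le_mul_of_one_le_right (by positivity) (by linarith)
      _ = _ := by rw [Constants.c]; ring
  · set b := D.right j with hbdef
    have hb : b ∈ Icc 0 P.T := ⟨hl0.trans hlr.le, hrT⟩
    have hQb : (P.extend hT.le).Q b = P.Q b := Problem.extend_Q hb
    have hsymm := h.inner_Q_symm b
    have hlow := h.le_inner_Q b
    have hupp := h.inner_Q_le b
    rw [hQb] at hsymm hlow hupp
    have hG : TerminalWeight K (P.Q b) := ⟨hsymm, hlow, hupp⟩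
    have hinv := isInvertible_of_le_inner hγ hlow
    have hcost : subTerminalCost P D j (x b - (P.Q b).inverse (lam b)) =
        fun z => (1 / 2) * inner ℝ z (P.Q b z) -
          inner ℝ z (P.Q b (x b - (P.Q b).inverse (lam b))) := by
      funext z; simp [subTerminalCost, hj, ← hbdef]
    have g1 : mu b = P.Q b (y b) - P.Q b (x b - (P.Q b).inverse (lam b)) := by
      have := hsub.adjoint_end
      rw [hcost] at this
      exact this.unique (hasGradientAt_quadratic hsymm _ _)
    rw [map_sub, hinv.self_apply_inverse] at g1
    set e₁ := ‖x b - xStar b‖ with he₁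
    set e₂ := ‖lam b - lamStar b‖ with he₂
    -- The new values `y(b)`, `μ(b)` cancel by the terminal condition, leaving the previous
    -- iterate's errors. Factoring out `λ_Q` costs `1/γ_Q` on the adjoint error, since `λ_Q / γ_Q ≥
    -- 1`.
    have hd : ‖(mu b - lamStar b) - P.Q b (y b - xStar b)‖ ≤
        K.lamQ * (e₁ + 1 / K.gamQ * e₂) := by
      have e1 : (mu b - lamStar b) - P.Q b (y b - xStar b) =
          (lam b - lamStar b) - P.Q b (x b - xStar b) := by
        rw [g1]; simp only [map_sub]; abel
      rw [e1]
      have n1 := (P.Q b).le_of_opNorm_le (hbdd.normQ b hb) (x b - xStar b)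
      have n2 : e₂ ≤ K.lamQ * (1 / K.gamQ) * e₂ := by
        refine le_mul_of_one_le_left (norm_nonneg _) ?_
        rw [mul_one_div, le_div_iff₀ hγ, one_mul]
        exact hcoer.gamQ_le
      refine (norm_sub_le _ _).trans ?_
      linarith
    have key := hdiff.norm_le_boundary h hc hl0 hlr hrT hG hd htmem
    have hright : Real.exp (-K.ρZ * (b - t)) ≤ Real.exp (-K.ρZ * D.τ) := by
      -- The forward overlap must not be truncated by `T` below `τ`; this is where `t_j + τ ≤ T`
      -- enters.
      have h1 : D.t j.succ + D.τ ≤ b :=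
        le_min (by linarith [(D.τ_le j).trans (min_le_right _ _)]) (hτ hj)
      have h3 : K.ρZ * D.τ ≤ K.ρZ * (b - t) := by gcongr; linarith [ht.2]
      exact Real.exp_le_exp.2 (by linarith)
    have hbe : boundaryError D j x lam xStar lamStar = e₀ + (e₁ + e₂) := by
      simp only [boundaryError, hj, if_false, he₀, he₁, he₂, hbdef]
    have he₁0 : 0 ≤ e₁ := norm_nonneg _
    have he₂0 : 0 ≤ e₂ := norm_nonneg _
    rw [hbe]
    calc _ ≤ _ := key
      _ ≤ K.Λb K.lamQ * (Real.exp (-K.ρZ * D.τ) * e₀ +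
          Real.exp (-K.ρZ * D.τ) * (e₁ + 1 / K.gamQ * e₂)) := by gcongr
      _ = K.Λb K.lamQ * Real.exp (-K.ρZ * D.τ) * (e₀ + (e₁ + 1 / K.gamQ * e₂)) := by ring
      _ ≤ K.Λb K.lamQ * Real.exp (-K.ρZ * D.τ) * ((1 + 1 / K.gamQ) * (e₀ + (e₁ + e₂))) := by
        gcongr
        nlinarith [mul_nonneg hone he₀0, mul_nonneg hone he₁0]
      _ = _ := by rw [Constants.c]; ring

end Schwarz

end

/-! ### The contraction estimate for the subproblem solutions and the aggregated iterate. -/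

theorem mainTheorem2 {nx nu m : ℕ} (P : Schwarz.Problem nx nu) (K : Schwarz.Constants)
    (hbdd : Schwarz.BoundedMatrices P K) (hucc : Schwarz.UniformlyControllable P K)
    (hcoer : Schwarz.Coercive P K)
    (D : Schwarz.Decomposition P.T m)
    (xStar : ℝ → Schwarz.Vec nx) (uStar : ℝ → Schwarz.Vec nu) (lamStar : ℝ → Schwarz.Vec nx)
    (hstar : Schwarz.IsFullSolution P xStar uStar lamStar)
    (x : ℕ → ℝ → Schwarz.Vec nx) (u : ℕ → ℝ → Schwarz.Vec nu) (lam : ℕ → ℝ → Schwarz.Vec nx)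
    (xs : ℕ → Fin m → ℝ → Schwarz.Vec nx) (us : ℕ → Fin m → ℝ → Schwarz.Vec nu)
    (lams : ℕ → Fin m → ℝ → Schwarz.Vec nx)
    (hrun : Schwarz.IsSchwarzRun P D x u lam xs us lams)
    (k : ℕ) (hk : 1 ≤ k) (j : Fin m)
    (hτ : j.succ ≠ Fin.last m → D.t j.succ + D.τ ≤ P.T) :
    (∀ t ∈ Set.Icc (D.t j.castSucc) (D.t j.succ),
      ‖xs k j t - xStar t‖ + ‖us k j t - uStar t‖ + ‖lams k j t - lamStar t‖ ≤
        K.c * Real.exp (-K.ρZ * D.τ) *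
          Schwarz.boundaryError D j (x (k - 1)) (lam (k - 1)) xStar lamStar) ∧
    (∀ t ∈ D.cell j,
      ‖x k t - xStar t‖ + ‖u k t - uStar t‖ + ‖lam k t - lamStar t‖ ≤
        K.c * Real.exp (-K.ρZ * D.τ) *
          Schwarz.boundaryError D j (x (k - 1)) (lam (k - 1)) xStar lamStar) := by
  obtain ⟨k, rfl⟩ := Nat.exists_eq_add_of_le' hk
  have main : ∀ t ∈ Set.Icc (D.t j.castSucc) (D.t j.succ),
      ‖xs (k + 1) j t - xStar t‖ + ‖us (k + 1) j t - uStar t‖ + ‖lams (k + 1) j t - lamStar t‖ ≤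
        K.c * Real.exp (-K.ρZ * D.τ) *
          Schwarz.boundaryError D j (x k) (lam k) xStar lamStar := fun t ht =>
    (hrun.solve k j).error_le hbdd hucc hcoer hstar (hrun.initial j.pos k) hτ ht
  refine ⟨main, fun t ht => ?_⟩
  obtain ⟨h1, h2, h3⟩ := hrun.aggregate k j t ht
  rw [h1, h2, h3]
  exact main t (D.cell_subset j ht)
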